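/- Let $b,c,m\ge 0$ be integers and $M=2^m$; let $p$ be a probability distribution on $\{0,1\}^b$, and let $\mathcal P$ be a unitary on $b$ qubits with $\mathcal P|0\rangle^{\otimes b}=\sum_{\xi}\sqrt{p(\xi)}\,|\xi\rangle$. Let $0<\delta\le 1$, $2^{-c}\le\lambda_t\le 1$, and $L_t=\lceil \log(2/\delta)/\sqrt{\lambda_t}\,\rceil$ (natural logarithm). For $f:\{0,1\}^b\times\{0,1\}^c\to\{0,1\}$ put $\lambda_\xi=2^{-c}\,|\{\phi: f(\xi,\phi)=1\}|$, $$\mu=\sum_{\xi:\ \exists \phi,\ f(\xi,\phi)=1}p(\xi),\qquad \epsilon_t=\sum_{\xi:\ 0<\lambda_\xi<\lambda_t}p(\xi),$$ and let $U_f|\xi,\phi,z\rangle=|\xi,\phi,z\oplus f(\xi,\phi)\rangle$. A quantum query algorithm is a finite sequence of steps, each being either a unitary that does not depend on $f$ or one application of $U_f$, applied to $|0\cdots0\rangle$ on $b+c+1+m$ qubits. There is a quantum query algorithm (depending on $\mathcal P,\delta,\lambda_t,m$, but not on $f$) that makes exactly $(L_t+1)(2M-1)$ calls to $U_f$ and has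 the following two properties for every $f$. (1) Its final state is that of canonical amplitude estimation applied to fixed-point amplitude amplification in every scenario $\xi$ at once. That is, let $L=2l+1$ be the least odd integer $\ge L_t$. Let $V=\mathcal P\otimes H^{\otimes c}$, $S_\Phi(\beta)=U_fZ(\beta)U_f$ with $Z(\beta)=\mathrm{diag}(1,e^{i\beta})$ on the ancilla $z$, $S_+(\alpha)=I-(1-e^{-i\alpha})\,I\otimes(|+\rangle\langle+|)^{\otimes c}$ (acting on the $c$ qubits of $\phi$), and $G(\alpha,\beta)=-S_+(\alpha)S_\Phi(\beta)$. For $1\le j\le l$ let $$\alpha_j=-\beta_{l-j+1}=2\cot^{-1}\!\Big(\tan(2\pi j/L)\sqrt{1-1/T_{1/L}(1/\delta)^2}\Big),\qquad T_{1/L}(x)=\cosh\big(\tfrac1L\operatorname{arcosh}x\big).$$ Put $\mathcal S_L=G(\alpha_l,\beta_l)\cdots G(\alpha_1,\beta_1)$, $\mathcal A=U_f\mathcal S_LV$ and $\mathcal Q=\mathcal A(I-2|0\rangle\langle0|)\mathcal A^\dagger(I\otimes(-Z))$, with $Z$ on the ancilla. The final state is obtained from $\mathcal A|0\rangle\otimes|+\rangle^{\otimes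 m}$ by applying $\mathcal Q^{2^j}$ controlled by the $j$-th sample qubit for each $0\le j<m$, and then the inverse quantum Fourier transform on the $m$ sample qubits. (2) If measuring the $m$ sample qubits gives the integer $d$ and $\tilde a=\sin^2(d\pi/M)$, then $$\Pr\Big[\,|\tilde a-\mu|\le \epsilon_t+\delta^2\mu-\delta^2\epsilon_t+\frac{\pi}{M}+\frac{\pi^2}{M^2}\Big]\ \ge\ \frac{8}{\pi^2}.$$ -/

import Mathlib

open scoped Kronecker Matrix

noncomputable section

namespace Reqo

/-! ### The problem: Nature draws `ξ`, the player answers with `φ` -/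

/-- Bit strings of length `k`. -/
abbrev Bits (k : ℕ) : Type := Fin k → Bool

/-- The all-zero bit string. -/
def zeroBits (k : ℕ) : Bits k := fun _ => false

/-- The fraction `λ_ξ` of the strings `φ` that complete `ξ`. -/
def completingFraction {b c : ℕ} (f : Bits b → Bits c → Bool) (ξ : Bits b) : ℝ :=
  ((Finset.univ.filter fun φ : Bits c => f ξ φ = true).card : ℝ) / 2 ^ c

/-- `μ`: the probability that Nature's string admits a completing string. -/
def mu {b c : ℕ} (p : Bits b → ℝ) (f : Bits b → Bits c → Bool) : ℝ :=
  ∑ ξ with ∃ φ, f ξ φ = true, p ξ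

/-- `ε_t`: the probability that Nature's string admits a completing string, but the fraction of
completing strings is below the threshold `lamT`. -/
def epsT {b c : ℕ} (p : Bits b → ℝ) (f : Bits b → Bits c → Bool) (lamT : ℝ) : ℝ :=
  ∑ ξ with (∃ φ, f ξ φ = true) ∧ completingFraction f ξ < lamT, p ξ

/-- `L_t = ⌈log (2 / δ) / √λ_t⌉`. -/
def depthT (δ lamT : ℝ) : ℕ := ⌈Real.log (2 / δ) / Real.sqrt lamT⌉₊

/-! ### Registers, states, and the oracle -/

/-- Basis labels of the working register: Nature's `b` bits, the player's `c` bits, and the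
ancilla bit on which the oracle answers. -/
abbrev Work (b c : ℕ) : Type := Bits b × Bits c × Bool

/-- Basis labels of the whole register: the working register and `m` sample qubits, whose basis
states are labelled by the integers `0, …, 2 ^ m - 1`. -/
abbrev Reg (b c m : ℕ) : Type := Work b c × Fin (2 ^ m)

/-- The label `0 … 0` of the working register. -/
def zeroWork (b c : ℕ) : Work b c := (zeroBits b, zeroBits c, false)

/-- The state `|0 … 0⟩` of the working register. -/
def ketZero (b c : ℕ) : Work b c → ℂ := Pi.single (zeroWork b c) 1

/-- The state `|0 … 0⟩` of the whole register. -/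
def initState (b c m : ℕ) : Reg b c m → ℂ :=
  Pi.single (zeroWork b c, ⟨0, Nat.two_pow_pos m⟩) 1

/-- The oracle unitary `U_f |ξ, φ, z⟩ = |ξ, φ, z ⊕ f(ξ, φ)⟩`. -/
def oracle {b c : ℕ} (f : Bits b → Bits c → Bool) : Matrix (Work b c) (Work b c) ℂ :=
  Matrix.of fun r s => if r = (s.1, s.2.1, xor s.2.2 (f s.1 s.2.1)) then 1 else 0

/-! ### The query model -/

/-- A step of a quantum query algorithm: a unitary that does not depend on the oracle, or one
call to the oracle. -/
inductive Gate (b c m : ℕ) : Type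
  | free (U : Matrix.unitaryGroup (Reg b c m) ℂ) : Gate b c m
  | query : Gate b c m

/-- The action of one step when the oracle is `f`. -/
def Gate.toMatrix {b c m : ℕ} (f : Bits b → Bits c → Bool) :
    Gate b c m → Matrix (Reg b c m) (Reg b c m) ℂ
  | .free U => U
  | .query => oracle f ⊗ₖ (1 : Matrix (Fin (2 ^ m)) (Fin (2 ^ m)) ℂ)

/-- The number of oracle calls of a step. -/
def Gate.cost {b c m : ℕ} : Gate b c m → ℕ
  | .free _ => 0
  | .query => 1

/-- A quantum query algorithm: a list of steps, the first one to be applied first. -/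
abbrev QueryAlgorithm (b c m : ℕ) : Type := List (Gate b c m)

/-- The number of oracle calls of an algorithm. -/
def queryCount {b c m : ℕ} (C : QueryAlgorithm b c m) : ℕ := (C.map Gate.cost).sum

/-- The state of the register after the algorithm is run from `|0 … 0⟩` with oracle `f`. -/
def finalState {b c m : ℕ} (C : QueryAlgorithm b c m) (f : Bits b → Bits c → Bool) :
    Reg b c m → ℂ :=
  C.foldl (fun ψ g => g.toMatrix f *ᵥ ψ) (initState b c m)

/-- The probability that measuring the sample qubits of `ψ` gives the integer `d`. -/
def outcomeProb {b c m : ℕ} (ψ : Reg b c m → ℂ) (d : Fin (2 ^ m)) : ℝ :=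
  ∑ w, ‖ψ (w, d)‖ ^ 2

/-- The estimate `sin² (d π / M)`, with `M = 2 ^ m`, computed from the measured integer `d`. -/
def estimate (m : ℕ) (d : Fin (2 ^ m)) : ℝ :=
  Real.sin ((d : ℝ) * Real.pi / 2 ^ m) ^ 2

/-! ### Fixed-point amplitude amplification in every scenario at once -/

/-- The one-qubit Hadamard gate. -/
def hadamardBit : Matrix Bool Bool ℂ :=
  Matrix.of fun s t => (if s && t then -1 else 1) / (Real.sqrt 2 : ℂ)

/-- The tensor power `H ^ ⊗ c`. -/
def hadamard (c : ℕ) : Matrix (Bits c) (Bits c) ℂ :=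
  Matrix.of fun s t => ∏ i, hadamardBit (s i) (t i)

/-- The state preparation `V = P ⊗ H ^ ⊗ c`, extended by the identity on the ancilla. -/
def prep {b : ℕ} (c : ℕ) (P : Matrix (Bits b) (Bits b) ℂ) : Matrix (Work b c) (Work b c) ℂ :=
  P ⊗ₖ (hadamard c ⊗ₖ (1 : Matrix Bool Bool ℂ))

/-- The phase `e ^ (i β)` on the state `|1⟩` of the ancilla. -/
def ancillaPhase (b c : ℕ) (β : ℝ) : Matrix (Work b c) (Work b c) ℂ :=
  Matrix.diagonal fun r => if r.2.2 then Complex.exp (Complex.I * β) else 1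

/-- `S_Φ(β) = U_f Z(β) U_f`; with the ancilla in `|0⟩` it multiplies `|ξ, φ⟩` by `e ^ (i β)` if
`f(ξ, φ) = 1` and fixes it otherwise. -/
def targetReflection {b c : ℕ} (f : Bits b → Bits c → Bool) (β : ℝ) :
    Matrix (Work b c) (Work b c) ℂ :=
  oracle f * ancillaPhase b c β * oracle f

/-- The projector `|+⟩⟨+| ^ ⊗ c`. -/
def plusProj (c : ℕ) : Matrix (Bits c) (Bits c) ℂ := Matrix.of fun _ _ => 1 / 2 ^ c

/-- `S_+(α) = I - (1 - e ^ (-i α)) I ⊗ |+⟩⟨+| ^ ⊗ c`, acting on the player's bits only. -/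
def plusReflection (b c : ℕ) (α : ℝ) : Matrix (Work b c) (Work b c) ℂ :=
  1 - (1 - Complex.exp (-(Complex.I * α))) •
    ((1 : Matrix (Bits b) (Bits b) ℂ) ⊗ₖ (plusProj c ⊗ₖ (1 : Matrix Bool Bool ℂ)))

/-- The Grover iterate `G(α, β) = - S_+(α) S_Φ(β)`. -/
def groverIterate {b c : ℕ} (f : Bits b → Bits c → Bool) (α β : ℝ) :
    Matrix (Work b c) (Work b c) ℂ :=
  -(plusReflection b c α * targetReflection f β)

/-- `T_{1/L}(1/δ) = cosh (arcosh (1/δ) / L)`, the Chebyshev function of fractional order. -/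
def chebRoot (δ : ℝ) (L : ℕ) : ℝ := Real.cosh (Real.arcosh (1 / δ) / L)

/-- `α_j = 2 arccot (tan (2 π j / L) √(1 - 1 / T_{1/L}(1/δ)²))`, where `L = 2 l + 1`. -/
def alphaPhase (δ : ℝ) (l j : ℕ) : ℝ :=
  2 * (Real.pi / 2 - Real.arctan (Real.tan (2 * Real.pi * j / (2 * l + 1 : ℕ)) *
    Real.sqrt (1 - 1 / chebRoot δ (2 * l + 1) ^ 2)))

/-- `β_j = - α_{l - j + 1}`. -/
def betaPhase (δ : ℝ) (l j : ℕ) : ℝ := -alphaPhase δ l (l + 1 - j)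

/-- The product `G(α_k, β_k) ⋯ G(α_1, β_1)` of the first `k` of `l` iterates. -/
def groverProduct {b c : ℕ} (f : Bits b → Bits c → Bool) (δ : ℝ) (l : ℕ) :
    ℕ → Matrix (Work b c) (Work b c) ℂ
  | 0 => 1
  | k + 1 => groverIterate f (alphaPhase δ l (k + 1)) (betaPhase δ l (k + 1)) *
      groverProduct f δ l k

/-- Fixed-point amplitude amplification `S_L = G(α_l, β_l) ⋯ G(α_1, β_1)` of depth
`L = 2 l + 1`. -/
def amplification {b c : ℕ} (f : Bits b → Bits c → Bool) (δ : ℝ) (l : ℕ) :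
    Matrix (Work b c) (Work b c) ℂ :=
  groverProduct f δ l l

/-! ### Canonical amplitude estimation -/

/-- `A = U_f S_L V`. -/
def algA {b c : ℕ} (P : Matrix (Bits b) (Bits b) ℂ) (f : Bits b → Bits c → Bool) (δ : ℝ)
    (l : ℕ) : Matrix (Work b c) (Work b c) ℂ :=
  oracle f * amplification f δ l * prep c P

/-- The reflection `I - 2 |0⟩⟨0|` of the working register. -/
def zeroReflection (b c : ℕ) : Matrix (Work b c) (Work b c) ℂ :=
  Matrix.diagonal fun r => if r = zeroWork b c then -1 else 1

/-- `I ⊗ (-Z)`, with `Z` on the ancilla. -/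
def negAncillaZ (b c : ℕ) : Matrix (Work b c) (Work b c) ℂ :=
  Matrix.diagonal fun r => if r.2.2 then 1 else -1

/-- `Q = A (I - 2 |0⟩⟨0|) A† (I ⊗ (-Z))`. -/
def algQ {b c : ℕ} (P : Matrix (Bits b) (Bits b) ℂ) (f : Bits b → Bits c → Bool) (δ : ℝ)
    (l : ℕ) : Matrix (Work b c) (Work b c) ℂ :=
  algA P f δ l * zeroReflection b c * (algA P f δ l)ᴴ * negAncillaZ b c

/-- `U ^ (2 ^ j)` on the working register, controlled by the `j`-th sample qubit. -/
def controlledPower {b c : ℕ} (m : ℕ) (U : Matrix (Work b c) (Work b c) ℂ) (j : ℕ) :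
    Matrix (Reg b c m) (Reg b c m) ℂ :=
  Matrix.blockDiagonal fun d : Fin (2 ^ m) => if (d : ℕ).testBit j then U ^ 2 ^ j else 1

/-- The quantum Fourier transform of the sample qubits. -/
def qft (m : ℕ) : Matrix (Fin (2 ^ m)) (Fin (2 ^ m)) ℂ :=
  Matrix.of fun d k =>
    Complex.exp (2 * Real.pi * Complex.I * (d : ℕ) * (k : ℕ) / 2 ^ m) / (Real.sqrt (2 ^ m) : ℂ)

/-- The state of the working register and the sample qubits before the measurement in canonical
amplitude estimation: prepare `A|0⟩ ⊗ |+⟩ ^ ⊗ m`, apply `Q ^ (2 ^ j)` controlled by the `j`-th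
sample qubit for every `j < m`, and apply the inverse quantum Fourier transform to the sample
qubits. -/
def estimationState {b c : ℕ} (m : ℕ) (P : Matrix (Bits b) (Bits b) ℂ)
    (f : Bits b → Bits c → Bool) (δ : ℝ) (l : ℕ) : Reg b c m → ℂ :=
  ((1 : Matrix (Work b c) (Work b c) ℂ) ⊗ₖ (qft m)ᴴ) *ᵥ
    (((List.range m).map (controlledPower m (algQ P f δ l))).prod *ᵥ
      fun r => (algA P f δ l *ᵥ ketZero b c) r.1 * (1 / (Real.sqrt (2 ^ m) : ℂ)))

end Reqo

end

open Reqo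

open scoped Kronecker Matrix

noncomputable section

namespace Reqo

/-! ### Chebyshev polynomials with phases -/

/-! The oracle and the iterates never mix different `ξ`. Within one scenario the state stays uniform
on the completing strings and uniform on the others, so amplification is the two-dimensional
recursion `iterAmp`. Put `w = √(1 - λ_ξ)`. Up to a common unit phase, the mean amplitude and `w`
times the failing amplitude run through the even and odd terms of the three-term recurrence
`quasiCheb` at `w`, with phases `-e^{iα_j}` and `-e^{iβ_j}` (`iterAmp_eq_quasiCheb`).

With `t = e^η`, `η = arcosh(1/δ)/L` and `ω = e^{2πi/L}`, these phases are `phaseRatio t (ω ^ k)`.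
For them the last term is `T_L(w cosh η) / T_L(cosh η)`, that is `δ T_L(w cosh η)`
(`quasiCheb_phaseRatio`). The reason is that the term is half the trace of a cyclic product of
transfer matrices. After clearing denominators and inserting a variable next to `ω ^ k`, cyclicity
of the trace leaves only the constant and the top coefficient, and both are traces of powers of a
fixed matrix. If `λ_ξ ≥ λ_t`, the choice of `L_t` gives `w cosh η ≤ 1`, so `|T_L| ≤ 1` and the
failure probability is at most `δ²` (`iterAmp_failure_le`). Averaging over `ξ` puts the success
probability `a` of `A|0⟩` between `(1 - δ²)(μ - ε_t)` and `μ`.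

`Q` rotates `A|0⟩` by `2θ` in the plane of its good and bad parts, where `a = sin² θ`. The outcome
law is therefore the average of two Fejér kernels centred at `θ` and `-θ`. In each, the two grid
points around the phase carry mass at least `8/π²` (`eight_div_pi_sq_le_sum_fejer`), and they give
`sin²` within `π/M` of `a`.

One use of `A` costs `L` calls. Amplitude estimation uses `A` or its adjoint `1 + 2(M - 1)` times,
because only the reflections inside `Q` need the control. If `L_t` is odd, `L` is one less than `L_t
+ 1`; the missing calls are spent on a state that the oracle fixes. -/

/-- The product `f (n - 1) ⋯ f 0`. -/
def descProd {R : Type*} [Monoid R] (f : ℕ → R) : ℕ → R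
  | 0 => 1
  | n + 1 => f n * descProd f n

lemma descProd_succ_right {R : Type*} [Monoid R] (f : ℕ → R) (n : ℕ) :
    descProd f (n + 1) = descProd (fun k => f (k + 1)) n * f 0 := by
  induction n with
  | zero => simp [descProd]
  | succ n ih => rw [descProd, ih, descProd, mul_assoc]

lemma map_descProd {R S : Type*} [Monoid R] [Monoid S] (g : R →* S) (f : ℕ → R) (n : ℕ) :
    g (descProd f n) = descProd (fun k => g (f k)) n := by
  induction n with
  | zero => simp [descProd]
  | succ n ih => simp [descProd, ih]

lemma descProd_congr {R : Type*} [Monoid R] {f g : ℕ → R} {n : ℕ} (h : ∀ k < n, f k = g k) :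
    descProd f n = descProd g n := by
  induction n with
  | zero => rfl
  | succ n ih =>
    rw [descProd, descProd, h n (by omega), ih fun k hk => h k (by omega)]

lemma descProd_const {R : Type*} [Monoid R] (a : R) (n : ℕ) :
    descProd (fun _ => a) n = a ^ n := by
  induction n with
  | zero => simp [descProd]
  | succ n ih => rw [descProd, ih, pow_succ']

lemma descProd_smul {K : Type*} [CommRing K] (c : ℕ → K)
    (f : ℕ → Matrix (Fin 2) (Fin 2) K) (n : ℕ) :
    descProd (fun k => c k • f k) n = (∏ k ∈ Finset.range n, c k) • descProd f n := by
  induction n with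
  | zero => simp [descProd]
  | succ n ih =>
    rw [descProd, ih, descProd, Finset.prod_range_succ, smul_mul_smul_comm, mul_comm]

/-- A product that is reflected to its inverse by `J` on factors is so as a whole. -/
lemma descProd_reflect {R : Type*} [Monoid R] (J : R) (f : ℕ → R) (n : ℕ)
    (h : ∀ k < n, f k * J * f (n - 1 - k) = J) :
    descProd f n * J * descProd f n = J := by
  -- The factors cancel in pairs outwards from `J`: the first `k` on the left against the last `k`
  -- on the right.
  have key : ∀ k ≤ n, descProd f k * J * descProd (fun i => f (n - k + i)) k = J := by
    intro k
    induction k with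
    | zero => simp [descProd]
    | succ k ih =>
      intro hk
      have h1 : descProd (fun i => f (n - (k + 1) + i)) (k + 1)
          = descProd (fun i => f (n - k + i)) k * f (n - 1 - k) := by
        rw [descProd_succ_right]
        congr 1
        · apply descProd_congr
          intro i _
          congr 1
          omega
        · congr 1
          omega
      calc descProd f (k + 1) * J * descProd (fun i => f (n - (k + 1) + i)) (k + 1)
          = f k * (descProd f k * J * descProd (fun i => f (n - k + i)) k) * f (n - 1 - k) := by
            rw [h1, descProd]; simp only [mul_assoc]
        _ = J := by rw [ih (by omega), h k (by omega)]
  simpa using key n le_rfl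

/-- The polynomials with `a 0 = 1`, `a 1 = x`,
`a (n + 2) = x (1 + e (n + 1)) a (n + 1) - e (n + 1) a n`. -/
def quasiCheb (e : ℕ → ℂ) (x : ℂ) : ℕ → ℂ
  | 0 => 1
  | 1 => x
  | n + 2 => x * (1 + e (n + 1)) * quasiCheb e x (n + 1) - e (n + 1) * quasiCheb e x n

/-- The transfer matrix of the recurrence of `quasiCheb`. -/
def transferMat (x e : ℂ) : Matrix (Fin 2) (Fin 2) ℂ := !![x * (1 + e), -e; 1, 0]

/-- Solved for its oldest term, the recurrence is the same recurrence with the inverse phase, and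
the swap reverses the pair of consecutive terms. -/
lemma transferMat_mul_swap_mul (x : ℂ) {e e' : ℂ} (h : e * e' = 1) :
    transferMat x e * !![0, 1; 1, 0] * transferMat x e' = !![0, 1; 1, 0] := by
  ext i j
  fin_cases i <;> fin_cases j <;>
    simp [transferMat, Matrix.mul_apply, Fin.sum_univ_two]
  · linear_combination (-x) * h
  · exact h

lemma descProd_transferMat_mulVec (e : ℕ → ℂ) (x : ℂ) (n : ℕ) :
    descProd (fun k => transferMat x (e (k + 1))) n *ᵥ ![x, 1]
      = ![quasiCheb e x (n + 1), quasiCheb e x n] := by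
  induction n with
  | zero => simp [descProd, quasiCheb]
  | succ n ih =>
    rw [descProd, ← Matrix.mulVec_mulVec, ih]
    ext i
    fin_cases i <;> simp [transferMat, quasiCheb, Matrix.mulVec, dotProduct, sub_eq_add_neg]

lemma det_descProd (f : ℕ → Matrix (Fin 2) (Fin 2) ℂ) (n : ℕ) :
    (descProd f n).det = ∏ k ∈ Finset.range n, (f k).det := by
  induction n with
  | zero => simp [descProd]
  | succ n ih => rw [descProd, Matrix.det_mul, ih, Finset.prod_range_succ, mul_comm]

/-- For a palindromic sequence of phases the last polynomial is half the trace of the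
monodromy matrix. -/
lemma two_mul_quasiCheb_eq_trace (e : ℕ → ℂ) (x : ℂ) (n : ℕ) (h0 : e 0 = 1)
    (hrefl : ∀ k < n, e (k + 1) * e (n - k) = 1)
    (hprod : ∏ k ∈ Finset.range n, e (k + 1) = 1) :
    2 * quasiCheb e x (n + 1)
      = (descProd (fun k => transferMat x (e k)) (n + 1)).trace := by
  set K := descProd (fun k => transferMat x (e (k + 1))) n with hK
  have hJ : K * !![0, 1; 1, 0] * K = !![0, 1; 1, 0] := by
    apply descProd_reflect
    intro k hk
    apply transferMat_mul_swap_mul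
    rw [← hrefl k hk]
    congr 2
    omega
  have hdet : K.det = 1 := by
    rw [hK, det_descProd, ← hprod]
    apply Finset.prod_congr rfl
    intro k _
    simp [transferMat, Matrix.det_fin_two]
  have hq : quasiCheb e x (n + 1) = K 0 0 * x + K 0 1 := by
    have := congrFun (descProd_transferMat_mulVec e x n) 0
    simpa [Matrix.mulVec, dotProduct, Fin.sum_univ_two] using this.symm
  rw [descProd_succ_right, ← hK, h0, hq]
  have e00 := congrFun (congrFun hJ 0) 0
  have e01 := congrFun (congrFun hJ 0) 1
  have e10 := congrFun (congrFun hJ 1) 0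
  have e11 := congrFun (congrFun hJ 1) 1
  rw [Matrix.det_fin_two] at hdet
  simp [Matrix.mul_apply, Fin.sum_univ_two] at e00 e01 e10 e11
  simp only [Matrix.trace_fin_two, transferMat, Matrix.mul_apply, Fin.sum_univ_two]
  simp
  -- If this sum `s` were nonzero, the corner entry of `K J K = J` would force `K 0 0 = 0`. The
  -- off-diagonal entries and `det K = 1` would then give `s² = 1 + 1 - 2 = 0`.
  have hs : K 0 1 + K 1 0 = 0 := by
    by_contra hne
    have hp : K 0 0 = 0 := by
      have : K 0 0 * (K 0 1 + K 1 0) = 0 := by linear_combination e00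
      simpa [hne] using this
    rw [hp] at hdet e01 e10
    have : (K 0 1 + K 1 0) ^ 2 = 0 := by linear_combination e01 + e10 - 2 * hdet
    exact hne (by simpa using this)
  linear_combination hs

/-! ### Traces of cyclic products by rotation invariance -/

/-- The transfer matrix cleared of denominators. -/
def cyclicMat {R : Type*} [CommRing R] (t t' X y : R) : Matrix (Fin 2) (Fin 2) R :=
  !![2 * X * (y + 1), -(t' * y + t); t * y + t', 0]

lemma natDegree_descProd_le {f : ℕ → Matrix (Fin 2) (Fin 2) (Polynomial ℂ)}
    (hf : ∀ k i j, (f k i j).natDegree ≤ 1) (n : ℕ) (i j : Fin 2) :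
    (descProd f n i j).natDegree ≤ n := by
  induction n generalizing i j with
  | zero =>
    fin_cases i <;> fin_cases j <;> simp [descProd]
  | succ n ih =>
    rw [descProd, Matrix.mul_apply]
    apply Polynomial.natDegree_sum_le_of_forall_le
    intro k _
    refine Polynomial.natDegree_mul_le.trans ?_
    have := hf n i k
    have := ih k j
    omega

/-- Only the linear part of every factor contributes to the top degree. -/
lemma coeff_descProd {f : ℕ → Matrix (Fin 2) (Fin 2) (Polynomial ℂ)}
    (hf : ∀ k i j, (f k i j).natDegree ≤ 1) (n : ℕ) (i j : Fin 2) :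
    (descProd f n i j).coeff n
      = descProd (fun k => (f k).map fun q => q.coeff 1) n i j := by
  induction n generalizing i j with
  | zero =>
    fin_cases i <;> fin_cases j <;> simp [descProd]
  | succ n ih =>
    rw [descProd, Matrix.mul_apply, descProd, Matrix.mul_apply, Polynomial.finsetSum_coeff]
    apply Finset.sum_congr rfl
    intro k _
    rw [add_comm n 1, Polynomial.coeff_mul_add_eq_of_natDegree_le (hf n i k)
      (natDegree_descProd_le hf n k j), ih, Matrix.map_apply]

/-- By Cayley–Hamilton the traces of the powers satisfy the recurrence of `2 cos (n z)`. -/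
lemma trace_pow_of_det_one (A : Matrix (Fin 2) (Fin 2) ℂ) (z : ℂ) (hdet : A.det = 1)
    (htr : A.trace = 2 * Complex.cos z) (n : ℕ) :
    (A ^ n).trace = 2 * Complex.cos (n * z) := by
  have hsq : A ^ 2 = (2 * Complex.cos z) • A - 1 := by
    rw [← htr]
    rw [Matrix.det_fin_two] at hdet
    ext i j
    fin_cases i <;> fin_cases j <;>
      simp [pow_two, Matrix.mul_apply, Fin.sum_univ_two, Matrix.trace_fin_two] <;>
      first | linear_combination -hdet | ring
  induction n using Nat.twoStepInduction with
  | zero => simp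
  | one => simpa using htr
  | more n h0 h1 =>
    have : A ^ (n + 2) = (2 * Complex.cos z) • A ^ (n + 1) - A ^ n := by
      rw [pow_add, hsq, mul_sub, mul_one, mul_smul_comm, pow_succ]
    rw [this, Matrix.trace_sub, Matrix.trace_smul, h0, h1]
    have e1 : ((n + 2 : ℕ) : ℂ) * z = (n + 1) * z + z := by push_cast; ring
    have e2 : (n : ℂ) * z = (n + 1) * z - z := by ring
    rw [e1, e2, Complex.cos_add, Complex.cos_sub]
    push_cast
    simp only [smul_eq_mul]
    ring

lemma prod_range_pow_eq_one {ω : ℂ} {n : ℕ} (hn : Odd n) (hω : ω ^ n = 1) :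
    ∏ k ∈ Finset.range n, ω ^ k = 1 := by
  obtain ⟨l, rfl⟩ := hn
  rw [Finset.prod_pow_eq_pow_sum, Finset.sum_range_id]
  have : (2 * l + 1) * (2 * l + 1 - 1) / 2 = (2 * l + 1) * l := by
    rw [Nat.add_sub_cancel, show (2 * l + 1) * (2 * l) = ((2 * l + 1) * l) * 2 by ring,
      Nat.mul_div_cancel _ (by norm_num)]
  rw [this, pow_mul, hω, one_pow]

/-- The factorization of `s ^ n + r ^ n` for odd `n`. It evaluates the product of the denominators,
and of the numerators, of the phases. -/
lemma prod_range_mul_pow_add {ω : ℂ} {n : ℕ} (hn : Odd n) (hω : IsPrimitiveRoot ω n) (s r : ℂ) :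
    ∏ k ∈ Finset.range n, (s * ω ^ k + r) = s ^ n + r ^ n := by
  rw [add_comm (s ^ n), hω.pow_add_pow_eq_prod_add_mul r s hn]
  refine Finset.prod_nbij (fun k => ω ^ k) ?_ ?_ ?_ ?_
  · intro k _
    rw [Polynomial.mem_nthRootsFinset hn.pos, ← pow_mul, mul_comm, pow_mul, hω.pow_eq_one, one_pow]
  · intro i hi j hj h
    exact hω.pow_inj (by simpa using hi) (by simpa using hj) h
  · intro x hx
    have : NeZero n := ⟨hn.pos.ne'⟩
    obtain ⟨i, hi, rfl⟩ := hω.eq_pow_of_pow_eq_one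
      ((Polynomial.mem_nthRootsFinset hn.pos 1).1 hx)
    exact ⟨i, by simpa using hi, rfl⟩
  · intro k _
    ring

/-- A polynomial of degree at most `n` that is invariant under rotation by a primitive `n`-th
root of unity is a combination of `1` and `X ^ n`. -/
lemma eval_one_of_rotation_invariant {ω : ℂ} {n : ℕ} (hn : 0 < n) (hω : IsPrimitiveRoot ω n)
    (q : Polynomial ℂ) (hdeg : q.natDegree ≤ n)
    (hq : q.comp (Polynomial.C ω * Polynomial.X) = q) :
    q.eval 1 = q.coeff 0 + q.coeff n := by
  have hz : ∀ k, 0 < k → k < n → q.coeff k = 0 := by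
    intro k hk hkn
    have h := congrArg (fun r => r.coeff k) hq
    simp only [Polynomial.comp_C_mul_X_coeff] at h
    have hne : ω ^ k ≠ 1 := hω.pow_ne_one_of_pos_of_lt hk.ne' hkn
    have : q.coeff k * (ω ^ k - 1) = 0 := by linear_combination h
    simpa [sub_eq_zero, hne] using this
  rw [Polynomial.eval_eq_sum_range' (Nat.lt_succ_of_le hdeg)]
  simp only [one_pow, mul_one]
  rw [Finset.sum_range_succ]
  congr 1
  rw [Finset.sum_eq_single_of_mem 0 (by simpa using hn)]
  intro k hk hk0
  exact hz k (Nat.pos_of_ne_zero hk0) (by simpa using hk)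

/-- With a variable `Y` next to `ω ^ k`, the trace is a polynomial in `Y` of degree at most `n`,
invariant under `Y ↦ ω Y`. Hence its value at `1` is the constant plus the top coefficient. Each is
the trace of an `n`-th power of a matrix of determinant `1` and trace `2 cos z`. -/
lemma trace_descProd_cyclicMat {ω t : ℂ} {n : ℕ} (hn : Odd n) (hω : IsPrimitiveRoot ω n)
    (ht : t ≠ 0) (z : ℂ) :
    (descProd (fun k => cyclicMat t t⁻¹ (Complex.cos z) (ω ^ k)) n).trace
      = 4 * Complex.cos (n * z) := by
  open Polynomial in
  set B : ℕ → Matrix (Fin 2) (Fin 2) ℂ[X] := fun k =>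
    cyclicMat (C t) (C t⁻¹) (C (Complex.cos z)) (C (ω ^ k) * X) with hB
  set q : Polynomial ℂ := (descProd B n).trace with hq
  have hdeg1 : ∀ k i j, (B k i j).natDegree ≤ 1 := by
    intro k i j
    fin_cases i <;> fin_cases j <;> simp [hB, cyclicMat] <;> compute_degree
  have hdeg : q.natDegree ≤ n := by
    rw [hq, Matrix.trace_fin_two]
    exact Polynomial.natDegree_add_le_of_degree_le (natDegree_descProd_le hdeg1 n 0 0)
      (natDegree_descProd_le hdeg1 n 1 1)
  have hev : ∀ y : ℂ, q.eval y
      = (descProd (fun k => cyclicMat t t⁻¹ (Complex.cos z) (ω ^ k * y)) n).trace := by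
    intro y
    have h1 := map_descProd (Polynomial.evalRingHom y).mapMatrix.toMonoidHom B n
    have h2 : q.eval y = ((Polynomial.evalRingHom y).mapMatrix (descProd B n)).trace := by
      simp [hq, Matrix.trace_fin_two]
    rw [h2]
    refine (congrArg Matrix.trace h1).trans ?_
    congr 1
    apply descProd_congr
    intro k _
    ext i j
    fin_cases i <;> fin_cases j <;> simp [hB, cyclicMat]
  have hrot : q.comp (Polynomial.C ω * Polynomial.X) = q := by
    have h1 := map_descProd
      (Polynomial.compRingHom (Polynomial.C ω * Polynomial.X)).mapMatrix.toMonoidHom B n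
    have h2 : q.comp (Polynomial.C ω * Polynomial.X)
        = ((Polynomial.compRingHom (Polynomial.C ω * Polynomial.X)).mapMatrix
          (descProd B n)).trace := by
      simp [hq, Matrix.trace_fin_two]
    have h3 : descProd (fun k =>
        (Polynomial.compRingHom (Polynomial.C ω * Polynomial.X)).mapMatrix.toMonoidHom (B k)) n
        = descProd (fun k => B (k + 1)) n := by
      apply descProd_congr
      intro k _
      ext1 i j
      fin_cases i <;> fin_cases j <;> simp [hB, cyclicMat, pow_succ, mul_assoc]
    rw [h2]
    refine (congrArg Matrix.trace (h1.trans h3)).trans ?_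
    obtain ⟨l, rfl⟩ := hn
    -- The substitution has shifted every index by one; `ω ^ n = 1` and cyclicity of the trace close
    -- the cycle.
    have hper : B (2 * l + 1) = B 0 := by
      simp only [hB, hω.pow_eq_one, pow_zero]
    rw [hq, descProd_succ_right B, Matrix.trace_mul_comm, ← hper]
    rfl
  have h0 : q.coeff 0 = 2 * Complex.cos (n * z) := by
    rw [Polynomial.coeff_zero_eq_eval_zero, hev]
    simp only [mul_zero]
    rw [descProd_const]
    apply trace_pow_of_det_one
    · simp [cyclicMat, Matrix.det_fin_two, ht]
    · simp [cyclicMat, Matrix.trace_fin_two]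
  have hL : q.coeff n = 2 * Complex.cos (n * z) := by
    rw [hq, Matrix.trace_fin_two, Polynomial.coeff_add, coeff_descProd hdeg1,
      coeff_descProd hdeg1, ← Matrix.trace_fin_two]
    have : ∀ k, ((B k).map fun q => q.coeff 1)
        = ω ^ k • !![2 * Complex.cos z, -t⁻¹; t, 0] := by
      intro k
      ext i j
      fin_cases i <;> fin_cases j <;>
        simp [hB, cyclicMat, Polynomial.coeff_one, mul_assoc, -map_pow,
          Polynomial.coeff_C] <;> ring
    simp only [this]
    rw [descProd_smul, prod_range_pow_eq_one hn hω.pow_eq_one, one_smul, descProd_const]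
    apply trace_pow_of_det_one
    · simp [Matrix.det_fin_two, ht]
    · simp [Matrix.trace_fin_two]
  have := hev 1
  rw [eval_one_of_rotation_invariant hn.pos hω q hdeg hrot, h0, hL] at this
  simp only [mul_one] at this
  rw [← this]
  ring

/-- The phase factor at the point `y` of the unit circle. -/
def phaseRatio (t y : ℂ) : ℂ := (t⁻¹ * y + t) / (t * y + t⁻¹)

/-- Inverting `y` exchanges numerator and denominator up to a common factor. On roots of unity this
is the palindromic symmetry required by `two_mul_quasiCheb_eq_trace`. -/
lemma phaseRatio_mul_eq_one {t y y' : ℂ} (h : y * y' = 1) (d1 : t * y + t⁻¹ ≠ 0)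
    (d2 : t * y' + t⁻¹ ≠ 0) : phaseRatio t y * phaseRatio t y' = 1 := by
  simp only [phaseRatio]
  rw [div_mul_div_comm, div_eq_one_iff_eq (mul_ne_zero d1 d2)]
  linear_combination (t⁻¹ * t⁻¹ - t * t) * h

/-- The phases `phaseRatio t (ω ^ k)` turn the last polynomial of the recurrence into a rescaled
Chebyshev polynomial. -/
theorem quasiCheb_phaseRatio {ω t x z : ℂ} {n : ℕ} (hn : Odd n) (hω : IsPrimitiveRoot ω n)
    (ht : t ≠ 0) (hden : ∀ k, t * ω ^ k + t⁻¹ ≠ 0) (hz : 2 * Complex.cos z = x * (t + t⁻¹)) :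
    quasiCheb (fun k => phaseRatio t (ω ^ k)) x n * (t ^ n + t⁻¹ ^ n)
      = 2 * Complex.cos (n * z) := by
  have hpos := hn.pos
  have hprod := prod_range_mul_pow_add hn hω
  obtain ⟨l, rfl⟩ := Nat.exists_eq_succ_of_ne_zero hpos.ne'
  have h0 : t + t⁻¹ ≠ 0 := by simpa using hden 0
  have htr := two_mul_quasiCheb_eq_trace (fun k => phaseRatio t (ω ^ k)) x l ?_ ?_ ?_
  · have hs : ∀ k, cyclicMat t t⁻¹ (Complex.cos z) (ω ^ k)
        = (t * ω ^ k + t⁻¹) • transferMat x (phaseRatio t (ω ^ k)) := by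
      intro k
      have hk := hden k
      ext i j
      fin_cases i <;> fin_cases j <;> simp [cyclicMat, transferMat, phaseRatio]
      · rw [hz, one_add_div hk, mul_left_comm, mul_div_cancel₀ _ hk]
        ring
      · rw [mul_div_cancel₀ _ hk]
        ring
    have h4 := trace_descProd_cyclicMat hn hω ht z
    simp only [hs] at h4
    rw [descProd_smul, hprod, Matrix.trace_smul, ← htr, smul_eq_mul] at h4
    linear_combination h4 / 2
  · simp [phaseRatio]
    rw [add_comm, div_self h0]
  · intro k hk
    have h1 : ω ^ (k + 1) * ω ^ (l - k) = 1 := by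
      rw [← pow_add, show k + 1 + (l - k) = l + 1 by omega, hω.pow_eq_one]
    exact phaseRatio_mul_eq_one h1 (hden (k + 1)) (hden (l - k))
  · have h1 := hprod t⁻¹ t
    have h2 := hprod t t⁻¹
    have h3 : t ^ (l + 1) + t⁻¹ ^ (l + 1) ≠ 0 := by
      rw [← h2, Finset.prod_ne_zero_iff]
      exact fun k _ => hden k
    rw [Finset.prod_range_succ', pow_zero, mul_one] at h1 h2
    simp only [phaseRatio]
    rw [Finset.prod_div_distrib, div_eq_one_iff_eq]
    · apply mul_right_cancel₀ h0
      rw [h2, add_comm (t ^ _), ← h1, add_comm t]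
    · rw [Finset.prod_ne_zero_iff]
      exact fun k _ => hden _

/-! ### The phases of fixed-point amplification -/

/-- `η = arcosh (1 / δ) / L`. -/
def etaParam (δ : ℝ) (l : ℕ) : ℝ := Real.arcosh (1 / δ) / (2 * l + 1 : ℕ)

lemma etaParam_nonneg {δ : ℝ} (hδ0 : 0 < δ) (hδ1 : δ ≤ 1) (l : ℕ) : 0 ≤ etaParam δ l :=
  div_nonneg (Real.arcosh_nonneg (one_le_one_div hδ0 hδ1)) (Nat.cast_nonneg _)

lemma sqrt_one_sub_inv_cosh_sq {η : ℝ} (hη : 0 ≤ η) :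
    Real.sqrt (1 - 1 / Real.cosh η ^ 2) = Real.sinh η / Real.cosh η := by
  have hc := Real.cosh_pos η
  have h : 1 - 1 / Real.cosh η ^ 2 = (Real.sinh η / Real.cosh η) ^ 2 := by
    rw [div_pow, Real.sinh_sq]
    field_simp
  rw [h, Real.sqrt_sq (div_nonneg (Real.sinh_nonneg_iff.2 hη) hc.le)]

lemma exp_neg_two_arctan (v : ℝ) :
    Complex.exp (-(2 * Complex.I * Real.arctan v))
      = (1 - Complex.I * v) / (1 + Complex.I * v) := by
  have hcpos := Real.cos_arctan_pos v
  have hc : (Real.cos (Real.arctan v) : ℂ) ≠ 0 := by exact_mod_cast hcpos.ne'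
  have hs : (Real.sin (Real.arctan v) : ℂ) = v * Real.cos (Real.arctan v) := by
    have h := Real.tan_arctan v
    rw [Real.tan_eq_sin_div_cos, div_eq_iff hcpos.ne'] at h
    exact_mod_cast h
  have h1 : Complex.exp (Real.arctan v * Complex.I)
      = Real.cos (Real.arctan v) * (1 + Complex.I * v) := by
    rw [Complex.exp_mul_I, ← Complex.ofReal_cos, ← Complex.ofReal_sin, hs]
    ring
  have h2 : Complex.exp (-(Real.arctan v) * Complex.I)
      = Real.cos (Real.arctan v) * (1 - Complex.I * v) := by
    rw [Complex.exp_mul_I, Complex.cos_neg, Complex.sin_neg, ← Complex.ofReal_cos,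
      ← Complex.ofReal_sin, hs]
    ring
  have h3 : (1 + Complex.I * v) ≠ 0 := by
    intro h0
    rw [h0, mul_zero] at h1
    exact Complex.exp_ne_zero _ h1
  rw [eq_div_iff h3]
  apply mul_left_cancel₀ hc
  rw [← h2, mul_left_comm, ← h1, ← Complex.exp_add]
  congr 1
  ring

/-- Expand the Cayley transform `(1 - iv) / (1 + iv)` by `2 e^{iθ} cosh η cos θ`. -/
lemma exp_neg_two_arctan_tan {η θ : ℝ} (hθ : Real.cos θ ≠ 0) :
    Complex.exp (-(2 * Complex.I *
        Real.arctan (Real.tan θ * (Real.sinh η / Real.cosh η))))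
      = phaseRatio (Real.exp η) (Complex.exp (2 * Complex.I * θ)) := by
  have hch : (Real.cosh η : ℂ) ≠ 0 := by exact_mod_cast (Real.cosh_pos η).ne'
  have hcs : (Real.cos θ : ℂ) ≠ 0 := by exact_mod_cast hθ
  have hE : Complex.exp (Complex.I * θ) ≠ 0 := Complex.exp_ne_zero _
  have ht : (Real.exp η : ℂ) ≠ 0 := by exact_mod_cast (Real.exp_pos η).ne'
  rw [exp_neg_two_arctan, phaseRatio]
  have hE1 : Complex.exp (Complex.I * θ) = Real.cos θ + Complex.I * Real.sin θ := by
    rw [mul_comm, Complex.exp_mul_I, ← Complex.ofReal_cos, ← Complex.ofReal_sin]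
    ring
  have hE2 : Complex.exp (2 * Complex.I * θ)
      = Complex.exp (Complex.I * θ) * (Real.cos θ + Complex.I * Real.sin θ) := by
    rw [← hE1, ← Complex.exp_add]
    congr 1
    ring
  have hE3 : Complex.exp (Complex.I * θ) * (Real.cos θ - Complex.I * Real.sin θ) = 1 := by
    have h := Real.cos_sq_add_sin_sq θ
    have h' : (Real.cos θ : ℂ) ^ 2 + (Real.sin θ : ℂ) ^ 2 = 1 := by exact_mod_cast h
    rw [hE1]
    linear_combination h' - (Real.sin θ : ℂ) ^ 2 * Complex.I_sq
  have hexp : (Real.exp η : ℂ) = Real.cosh η + Real.sinh η := by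
    exact_mod_cast (Real.cosh_add_sinh η).symm
  have hexp' : (Real.exp η : ℂ)⁻¹ = Real.cosh η - Real.sinh η := by
    rw [← Complex.ofReal_inv, ← Real.exp_neg]
    exact_mod_cast (Real.cosh_sub_sinh η).symm
  have num : (Real.exp η : ℂ)⁻¹ * Complex.exp (2 * Complex.I * θ) + Real.exp η
      = (2 * Complex.exp (Complex.I * θ) * Real.cosh η * Real.cos θ) *
        (1 - Complex.I * (Real.tan θ * (Real.sinh η / Real.cosh η) : ℝ)) := by
    rw [Real.tan_eq_sin_div_cos]
    simp only [Complex.ofReal_mul, Complex.ofReal_div]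
    rw [hexp', hexp, hE2]
    field_simp
    linear_combination (-(Real.cosh η : ℂ) - Real.sinh η) * hE3
  have den : (Real.exp η : ℂ) * Complex.exp (2 * Complex.I * θ) + (Real.exp η : ℂ)⁻¹
      = (2 * Complex.exp (Complex.I * θ) * Real.cosh η * Real.cos θ) *
        (1 + Complex.I * (Real.tan θ * (Real.sinh η / Real.cosh η) : ℝ)) := by
    rw [Real.tan_eq_sin_div_cos]
    simp only [Complex.ofReal_mul, Complex.ofReal_div]
    rw [hexp', hexp, hE2]
    field_simp
    linear_combination (-(Real.cosh η : ℂ) + Real.sinh η) * hE3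
  rw [num, den, mul_div_mul_left]
  exact mul_ne_zero (mul_ne_zero (mul_ne_zero two_ne_zero hE) hch) hcs

/-- The primitive root of unity `e ^ (2 π i / L)`, `L = 2 l + 1`. -/
def rootL (l : ℕ) : ℂ := Complex.exp (2 * Real.pi * Complex.I / (2 * l + 1 : ℕ))

lemma rootL_isPrimitiveRoot (l : ℕ) : IsPrimitiveRoot (rootL l) (2 * l + 1) :=
  Complex.isPrimitiveRoot_exp _ (by omega)

/-- Since `L` is odd, the `L`-th powers of `t ω ^ k` and `-t⁻¹` are real of opposite sign. -/
lemma mul_rootL_pow_add_inv_ne_zero {t : ℝ} (ht : 0 < t) (l k : ℕ) :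
    (t : ℂ) * rootL l ^ k + (t : ℂ)⁻¹ ≠ 0 := by
  intro h
  have hodd : Odd (2 * l + 1) := ⟨l, rfl⟩
  have h1 : ((t : ℂ) * rootL l ^ k) ^ (2 * l + 1) = (-(t : ℂ)⁻¹) ^ (2 * l + 1) := by
    rw [eq_neg_of_add_eq_zero_left h]
  rw [hodd.neg_pow, mul_pow, ← pow_mul, mul_comm k, pow_mul, (rootL_isPrimitiveRoot l).pow_eq_one,
    one_pow, mul_one] at h1
  have h2 : t ^ (2 * l + 1) = -t⁻¹ ^ (2 * l + 1) := by exact_mod_cast h1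
  have : 0 < t ^ (2 * l + 1) := by positivity
  have : 0 < t⁻¹ ^ (2 * l + 1) := by positivity
  linarith

/-- The phase factors of the amplification in the recurrence of `quasiCheb`. -/
def fpPhase (δ : ℝ) (l k : ℕ) : ℂ := phaseRatio (Real.exp (etaParam δ l)) (rootL l ^ k)

/-- The tangent in `alphaPhase` has no pole: a zero of the cosine would make `4 j` an odd multiple
of the odd number `L`. -/
lemma cos_two_pi_mul_div_odd_ne_zero (l j : ℕ) :
    Real.cos (2 * Real.pi * j / (2 * l + 1 : ℕ)) ≠ 0 := by
  intro h
  obtain ⟨k, hk⟩ := Real.cos_eq_zero_iff.1 h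
  have hL : ((2 * l + 1 : ℕ) : ℝ) ≠ 0 := by positivity
  rw [div_eq_iff hL] at hk
  have hpi := Real.pi_ne_zero
  have h4 : (4 * j : ℝ) = (2 * k + 1) * (2 * l + 1 : ℕ) := by
    apply mul_left_cancel₀ hpi
    linear_combination 2 * hk
  have h5 : (4 * j : ℤ) = (2 * k + 1) * (2 * l + 1) := by exact_mod_cast h4
  have h6 : (4 * j : ℤ) = 2 * (2 * k * l + k + l) + 1 := by rw [h5]; ring
  omega

/-- Writing `arccot` as `π/2 - arctan` turns the minus sign into the phase `-π`. The `α_j` supply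
the even-indexed phases of the recurrence. -/
lemma neg_exp_alphaPhase {δ : ℝ} (hδ0 : 0 < δ) (hδ1 : δ ≤ 1) (l j : ℕ) :
    -Complex.exp (Complex.I * alphaPhase δ l j) = fpPhase δ l (2 * j) := by
  have h := exp_neg_two_arctan_tan (η := etaParam δ l) (cos_two_pi_mul_div_odd_ne_zero l j)
  rw [fpPhase, alphaPhase, show chebRoot δ (2 * l + 1) = Real.cosh (etaParam δ l) from rfl,
    sqrt_one_sub_inv_cosh_sq (etaParam_nonneg hδ0 hδ1 l)]
  convert h using 1
  · have hm : (-1 : ℂ) = Complex.exp (-(Real.pi * Complex.I)) := by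
      rw [Complex.exp_neg, Complex.exp_pi_mul_I]
      norm_num
    rw [← neg_one_mul, hm, ← Complex.exp_add]
    congr 1
    push_cast
    ring
  · rw [rootL, ← Complex.exp_nat_mul]
    congr 2
    push_cast
    ring

/-- The `β_j` supply the odd-indexed phases. The relation to `α` is the palindromic symmetry, since
`2k + 1` and `2(l - k)` add up to `L`. -/
lemma neg_exp_betaPhase {δ : ℝ} (hδ0 : 0 < δ) (hδ1 : δ ≤ 1) {l k : ℕ} (hk : k < l) :
    -Complex.exp (Complex.I * betaPhase δ l (k + 1)) = fpPhase δ l (2 * k + 1) := by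
  have h := neg_exp_alphaPhase hδ0 hδ1 l (l - k)
  have h1 : fpPhase δ l (2 * k + 1) * fpPhase δ l (2 * (l - k)) = 1 := by
    apply phaseRatio_mul_eq_one
    · rw [← pow_add, show 2 * k + 1 + 2 * (l - k) = 2 * l + 1 by omega,
        (rootL_isPrimitiveRoot l).pow_eq_one]
    · exact mul_rootL_pow_add_inv_ne_zero (Real.exp_pos _) _ _
    · exact mul_rootL_pow_add_inv_ne_zero (Real.exp_pos _) _ _
  rw [← h] at h1
  apply mul_right_cancel₀ (b := -Complex.exp (Complex.I * alphaPhase δ l (l - k)))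
    (neg_ne_zero.2 (Complex.exp_ne_zero _))
  rw [h1, betaPhase, show l + 1 - (k + 1) = l - k by omega, neg_mul_neg, ← Complex.exp_add]
  simp

/-! ### Amplification in one scenario -/

/-- The relative amplitudes of the completing and of the other strings after `k` iterates, when
a fraction `lam` of the strings is completing. -/
def iterAmp (δ : ℝ) (l : ℕ) (lam : ℝ) : ℕ → ℂ × ℂ
  | 0 => (1, 1)
  | k + 1 =>
    let x := Complex.exp (Complex.I * betaPhase δ l (k + 1)) * (iterAmp δ l lam k).1
    let y := (iterAmp δ l lam k).2
    let u := (1 - Complex.exp (-(Complex.I * alphaPhase δ l (k + 1)))) *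
      (lam * x + (1 - lam) * y)
    (-(x - u), -(y - u))

/-- Each iterate advances the recurrence by two terms: the phase `β` produces the next mean, and the
reflection by `α` the next failing amplitude. The common phase `c` absorbs a factor `-e^{iα}` per
iterate. -/
lemma iterAmp_eq_quasiCheb {δ : ℝ} (hδ0 : 0 < δ) (hδ1 : δ ≤ 1) (l : ℕ) {lam w : ℝ}
    (hw : w ^ 2 = 1 - lam) (k : ℕ) (hk : k ≤ l) :
    ∃ c : ℂ, ‖c‖ = 1 ∧
      c * (lam * (iterAmp δ l lam k).1 + (1 - lam) * (iterAmp δ l lam k).2)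
        = quasiCheb (fpPhase δ l) w (2 * k) ∧
      c * (w * (iterAmp δ l lam k).2) = quasiCheb (fpPhase δ l) w (2 * k + 1) := by
  induction k with
  | zero => exact ⟨1, by simp, by simp [iterAmp, quasiCheb], by simp [iterAmp, quasiCheb]⟩
  | succ k ih =>
    obtain ⟨c, hc, hu, hy⟩ := ih (by omega)
    have hα := neg_exp_alphaPhase hδ0 hδ1 l (k + 1)
    have hβ := neg_exp_betaPhase hδ0 hδ1 (k := k) (l := l) (by omega)
    have hw' : (w : ℂ) ^ 2 = 1 - lam := by exact_mod_cast hw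
    set x := (iterAmp δ l lam k).1
    set y := (iterAmp δ l lam k).2
    set A := Complex.exp (Complex.I * alphaPhase δ l (k + 1)) with hA
    set B := Complex.exp (Complex.I * betaPhase δ l (k + 1)) with hB
    have hAinv : A * Complex.exp (-(Complex.I * alphaPhase δ l (k + 1))) = 1 := by
      rw [hA, ← Complex.exp_add]; simp
    set A' := Complex.exp (-(Complex.I * alphaPhase δ l (k + 1))) with hA'
    have h2 : quasiCheb (fpPhase δ l) w (2 * k + 2) = c * (lam * (B * x) + (1 - lam) * y) := by
      rw [quasiCheb, ← hβ, ← hu, ← hy]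
      linear_combination (1 - B) * c * y * hw'
    refine ⟨-A * c, ?_, ?_, ?_⟩
    · rw [norm_mul, norm_neg, hc, hA, mul_comm Complex.I, Complex.norm_exp_ofReal_mul_I, one_mul]
    · rw [show 2 * (k + 1) = 2 * k + 2 by ring, h2]
      simp only [iterAmp]
      linear_combination c * (lam * (B * x) + (1 - lam) * y) * hAinv
    · rw [show 2 * (k + 1) + 1 = (2 * k + 1) + 2 by ring, quasiCheb,
        show 2 * k + 1 + 1 = 2 * (k + 1) by ring, ← hα,
        show 2 * (k + 1) = 2 * k + 2 by ring, h2, ← hy]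
      simp only [iterAmp]
      linear_combination c * w * (lam * (B * x) + (1 - lam) * y) * hAinv

/-- Unitarity of the reflection in the weighted plane, which comes down to `|κ|² = 2 Re κ` for `κ =
1 - e^{-iα}`. -/
lemma iterAmp_norm {δ : ℝ} (l : ℕ) (lam : ℝ) (k : ℕ) :
    lam * ‖(iterAmp δ l lam k).1‖ ^ 2 + (1 - lam) * ‖(iterAmp δ l lam k).2‖ ^ 2 = 1 := by
  induction k with
  | zero => simp [iterAmp]
  | succ k ih =>
    simp only [iterAmp]
    set x := Complex.exp (Complex.I * betaPhase δ l (k + 1)) * (iterAmp δ l lam k).1 with hx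
    set y := (iterAmp δ l lam k).2
    have hxn : ‖x‖ = ‖(iterAmp δ l lam k).1‖ := by
      rw [hx, norm_mul, mul_comm Complex.I, Complex.norm_exp_ofReal_mul_I, one_mul]
    rw [← hxn] at ih
    set κ := 1 - Complex.exp (-(Complex.I * alphaPhase δ l (k + 1))) with hκ
    have hk2 : κ.re ^ 2 + κ.im ^ 2 = 2 * κ.re := by
      have h : ‖Complex.exp (-(Complex.I * alphaPhase δ l (k + 1)))‖ ^ 2 = 1 := by
        rw [← mul_neg, ← Complex.ofReal_neg, mul_comm Complex.I, Complex.norm_exp_ofReal_mul_I,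
          one_pow]
      rw [show Complex.exp (-(Complex.I * alphaPhase δ l (k + 1))) = 1 - κ by rw [hκ]; ring,
        Complex.sq_norm, Complex.normSq_apply] at h
      simp at h
      linear_combination h
    simp only [norm_neg]
    rw [Complex.sq_norm, Complex.sq_norm, Complex.normSq_apply, Complex.normSq_apply] at ih ⊢
    simp
    linear_combination ih + ((lam * x.re + (1 - lam) * y.re) ^ 2
      + (lam * x.im + (1 - lam) * y.im) ^ 2) * hk2

lemma arcosh_le_log_two_mul {x : ℝ} (hx : 1 ≤ x) : Real.arcosh x ≤ Real.log (2 * x) := by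
  rw [Real.arcosh]
  apply Real.log_le_log (by positivity)
  have : Real.sqrt (x ^ 2 - 1) ≤ x := by
    rw [Real.sqrt_le_left (by linarith)]
    linarith
  linarith

/-- This explains the choice of `L_t`: `arcosh (1/δ) ≤ log (2/δ) ≤ L_t √λ_t`, and `2 (L_t / 2) + 1`
is the least odd integer at least `L_t`. -/
lemma etaParam_le_sqrt {δ lamT : ℝ} (hδ0 : 0 < δ) (hδ1 : δ ≤ 1) (hlam : 0 < lamT) :
    etaParam δ (depthT δ lamT / 2) ≤ Real.sqrt lamT := by
  have hs : 0 < Real.sqrt lamT := Real.sqrt_pos.2 hlam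
  have h1 := arcosh_le_log_two_mul (one_le_one_div hδ0 hδ1)
  have h2 : Real.log (2 / δ) / Real.sqrt lamT ≤ depthT δ lamT := Nat.le_ceil _
  have h3 : depthT δ lamT ≤ 2 * (depthT δ lamT / 2) + 1 := by omega
  have h4 : (depthT δ lamT : ℝ) ≤ (2 * (depthT δ lamT / 2) + 1 : ℕ) := by exact_mod_cast h3
  rw [etaParam, div_le_iff₀ (by positivity)]
  rw [div_le_iff₀ hs] at h2
  calc Real.arcosh (1 / δ) ≤ Real.log (2 / δ) := by rwa [mul_one_div] at h1
    _ ≤ depthT δ lamT * Real.sqrt lamT := h2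
    _ ≤ _ := by rw [mul_comm]; gcongr

/-- Above the threshold, amplification fails with probability at most `δ²`. -/
theorem iterAmp_failure_le {δ lamT lam : ℝ} (hδ0 : 0 < δ) (hδ1 : δ ≤ 1) (hlam : 0 < lamT)
    (h : lamT ≤ lam) (h1 : lam ≤ 1) :
    (1 - lam) * ‖(iterAmp δ (depthT δ lamT / 2) lam (depthT δ lamT / 2)).2‖ ^ 2 ≤ δ ^ 2 := by
  set l := depthT δ lamT / 2 with hl
  set η := etaParam δ l with hη
  set w := Real.sqrt (1 - lam) with hwdef
  have hw : w ^ 2 = 1 - lam := Real.sq_sqrt (by linarith)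
  have hw0 : 0 ≤ w := Real.sqrt_nonneg _
  have hη0 : 0 ≤ η := etaParam_nonneg hδ0 hδ1 l
  have hη2 : η ^ 2 ≤ lam := by
    calc η ^ 2 ≤ Real.sqrt lamT ^ 2 := by
          gcongr
          exact etaParam_le_sqrt hδ0 hδ1 hlam
      _ = lamT := Real.sq_sqrt hlam.le
      _ ≤ lam := h
  have hch := Real.cosh_pos η
  -- From `1 - λ ≤ e^{-λ}` and `cosh η ≤ e^{η²/2}`, the square is at most `e^{η² - λ}`.
  have hX : w * Real.cosh η ≤ 1 := by
    have : (w * Real.cosh η) ^ 2 ≤ 1 := by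
      calc (w * Real.cosh η) ^ 2 = (1 - lam) * Real.cosh η ^ 2 := by rw [mul_pow, hw]
        _ ≤ Real.exp (-lam) * Real.exp (η ^ 2 / 2) ^ 2 := by
            gcongr
            · linarith [Real.add_one_le_exp (-lam)]
            · exact Real.cosh_le_exp_half_sq η
        _ = Real.exp (-lam + η ^ 2) := by
            rw [← Real.exp_nat_mul, ← Real.exp_add]
            congr 1
            push_cast
            ring
        _ ≤ 1 := Real.exp_le_one_iff.2 (by linarith)
    exact (sq_le_one_iff₀ (by positivity)).1 this
  set z := Real.arccos (w * Real.cosh η) with hz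
  have hcz : Real.cos z = w * Real.cosh η :=
    Real.cos_arccos (by linarith [mul_nonneg hw0 hch.le]) hX
  obtain ⟨c, hc, -, hy⟩ := iterAmp_eq_quasiCheb hδ0 hδ1 l hw l le_rfl
  have hq := quasiCheb_phaseRatio (x := (w : ℂ)) (z := (z : ℂ)) (n := 2 * l + 1) ⟨l, rfl⟩
    (rootL_isPrimitiveRoot l) (t := (Real.exp η : ℂ)) (by exact_mod_cast (Real.exp_pos η).ne')
    (fun k => mul_rootL_pow_add_inv_ne_zero (Real.exp_pos _) _ _) (by
      rw [← Complex.ofReal_cos, hcz, Real.cosh_eq, Real.exp_neg]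
      push_cast
      ring)
  have hq' : quasiCheb (fpPhase δ l) w (2 * l + 1)
      * ((Real.exp η : ℂ) ^ (2 * l + 1) + (Real.exp η : ℂ)⁻¹ ^ (2 * l + 1))
        = 2 * Complex.cos ((2 * l + 1 : ℕ) * z) := hq
  -- This is `2 cosh (L η)`, and `η` was chosen so that `L η = arcosh (1/δ)`.
  have hT : (Real.exp η : ℂ) ^ (2 * l + 1) + (Real.exp η : ℂ)⁻¹ ^ (2 * l + 1)
      = ((2 / δ : ℝ) : ℂ) := by
    have hL : ((2 * l + 1 : ℕ) : ℝ) ≠ 0 := by positivity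
    have h1 : Real.cosh ((2 * l + 1 : ℕ) * η) = 1 / δ := by
      rw [hη, etaParam, mul_div_cancel₀ _ hL, Real.cosh_arcosh (one_le_one_div hδ0 hδ1)]
    rw [Real.cosh_eq, Real.exp_neg, Real.exp_nat_mul] at h1
    rw [show 2 / δ = 2 * (1 / δ) by ring, ← h1]
    push_cast
    ring
  rw [hT, ← hy] at hq'
  have hn := congrArg norm hq'
  rw [show (2 : ℂ) * Complex.cos ((2 * l + 1 : ℕ) * z)
    = ((2 * Real.cos ((2 * l + 1 : ℕ) * z) : ℝ) : ℂ) by push_cast; rfl] at hn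
  rw [norm_mul, norm_mul, norm_mul, hc, Complex.norm_real, Complex.norm_real, Complex.norm_real,
    Real.norm_of_nonneg hw0, Real.norm_of_nonneg (by positivity : 0 ≤ 2 / δ), Real.norm_eq_abs,
    abs_mul, abs_two, one_mul] at hn
  have hb := Real.abs_cos_le_one ((2 * l + 1 : ℕ) * z)
  have hf : w * ‖(iterAmp δ l lam l).2‖ ≤ δ := by
    have : w * ‖(iterAmp δ l lam l).2‖ * (2 / δ) ≤ 2 := by rw [hn]; linarith
    rw [mul_div_assoc', div_le_iff₀ hδ0] at this
    linarith
  calc (1 - lam) * ‖(iterAmp δ l lam l).2‖ ^ 2 = (w * ‖(iterAmp δ l lam l).2‖) ^ 2 := by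
        rw [mul_pow, hw]
    _ ≤ δ ^ 2 := by gcongr

/-! ### The amplified state -/

lemma oracle_mulVec {b c : ℕ} (f : Bits b → Bits c → Bool) (ψ : Work b c → ℂ) (r : Work b c) :
    (oracle f *ᵥ ψ) r = ψ (r.1, r.2.1, xor r.2.2 (f r.1 r.2.1)) := by
  obtain ⟨ξ, φ, z⟩ := r
  rw [Matrix.mulVec, dotProduct, Finset.sum_eq_single (ξ, φ, xor z (f ξ φ))]
  · simp [oracle]
  · rintro ⟨ξ', φ', z'⟩ - hne
    have : ¬ ((ξ, φ, z) = (ξ', φ', xor z' (f ξ' φ'))) := by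
      rintro h
      simp only [Prod.mk.injEq] at h
      obtain ⟨rfl, rfl, rfl⟩ := h
      simp at hne
    simp [oracle, this]
  · simp

lemma plusReflection_mulVec {b c : ℕ} (α : ℝ) (ψ : Work b c → ℂ) (ξ : Bits b) (φ : Bits c)
    (z : Bool) :
    (plusReflection b c α *ᵥ ψ) (ξ, φ, z) = ψ (ξ, φ, z)
      - (1 - Complex.exp (-(Complex.I * α))) * ((∑ φ', ψ (ξ, φ', z)) / 2 ^ c) := by
  rw [plusReflection, Matrix.sub_mulVec, Matrix.one_mulVec, Matrix.smul_mulVec]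
  simp only [Pi.sub_apply, Pi.smul_apply, smul_eq_mul]
  congr 2
  rw [Matrix.mulVec, dotProduct, Fintype.sum_prod_type]
  simp only [Fintype.sum_prod_type, Matrix.kroneckerMap_apply, plusProj, Matrix.one_apply,
    Matrix.of_apply]
  simp [div_eq_inv_mul, Finset.mul_sum]

lemma hadamard_apply_zero {c : ℕ} (φ : Bits c) :
    hadamard c φ (zeroBits c) = (1 / (Real.sqrt 2 : ℂ)) ^ c := by
  simp [hadamard, hadamardBit, zeroBits]

lemma prep_mulVec_ketZero {b c : ℕ} (P : Matrix (Bits b) (Bits b) ℂ) (r : Work b c) :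
    (prep c P *ᵥ ketZero b c) r
      = if r.2.2 then 0 else P r.1 (zeroBits b) * (1 / (Real.sqrt 2 : ℂ)) ^ c := by
  obtain ⟨ξ, φ, z⟩ := r
  rw [ketZero, Matrix.mulVec_single_one, Matrix.col_apply, prep, zeroWork]
  simp only [Matrix.kroneckerMap_apply, hadamard_apply_zero, Matrix.one_apply]
  cases z <;> simp

/-- The sum over the player's strings of a function that only distinguishes completing strings. -/
lemma sum_ite_completing {b c : ℕ} (f : Bits b → Bits c → Bool) (ξ : Bits b) (x y : ℂ) :
    (∑ φ, if f ξ φ then x else y) / 2 ^ c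
      = completingFraction f ξ * x + (1 - completingFraction f ξ) * y := by
  have h2 : (2 : ℂ) ^ c ≠ 0 := pow_ne_zero _ two_ne_zero
  have hcard : (Finset.univ.filter fun φ : Bits c => f ξ φ = true).card
      + (Finset.univ.filter fun φ : Bits c => ¬ f ξ φ = true).card = 2 ^ c := by
    rw [Finset.card_filter_add_card_filter_not]
    simp
  have hcard' : ((Finset.univ.filter fun φ : Bits c => f ξ φ = true).card : ℂ)
      + ((Finset.univ.filter fun φ : Bits c => ¬ f ξ φ = true).card : ℂ) = 2 ^ c := by
    exact_mod_cast hcard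
  rw [Finset.sum_ite, Finset.sum_const, Finset.sum_const, completingFraction]
  push_cast
  simp only [nsmul_eq_mul]
  field_simp
  linear_combination y * hcard'

/-- The form of the state is preserved because the oracle phase only sees `f`, and the reflection
about `|+⟩` only subtracts a multiple of the mean over `φ` for fixed `ξ`. -/
lemma groverIterate_mulVec {b c : ℕ} (f : Bits b → Bits c → Bool) (α β : ℝ)
    (g : Bits b → ℂ) (x y : Bits b → ℂ) (r : Work b c) :
    (groverIterate f α β *ᵥ fun r : Work b c =>
        if r.2.2 then 0 else g r.1 * (if f r.1 r.2.1 then x r.1 else y r.1)) r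
      = if r.2.2 then 0 else g r.1 *
          (if f r.1 r.2.1 then
            -(Complex.exp (Complex.I * β) * x r.1 - (1 - Complex.exp (-(Complex.I * α))) *
              (completingFraction f r.1 * (Complex.exp (Complex.I * β) * x r.1)
                + (1 - completingFraction f r.1) * y r.1))
          else
            -(y r.1 - (1 - Complex.exp (-(Complex.I * α))) *
              (completingFraction f r.1 * (Complex.exp (Complex.I * β) * x r.1)
                + (1 - completingFraction f r.1) * y r.1))) := by
  have ht : (targetReflection f β *ᵥ fun r : Work b c =>
        if r.2.2 then 0 else g r.1 * (if f r.1 r.2.1 then x r.1 else y r.1))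
      = fun r : Work b c => if r.2.2 then 0 else g r.1 *
        (if f r.1 r.2.1 then Complex.exp (Complex.I * β) * x r.1 else y r.1) := by
    ext ⟨ξ, φ, z⟩
    rw [targetReflection, ← Matrix.mulVec_mulVec, ← Matrix.mulVec_mulVec, oracle_mulVec,
      ancillaPhase, Matrix.mulVec_diagonal, oracle_mulVec]
    cases z <;> cases f ξ φ <;> simp
    ring
  obtain ⟨ξ, φ, z⟩ := r
  rw [groverIterate, Matrix.neg_mulVec, ← Matrix.mulVec_mulVec, ht, Pi.neg_apply,
    plusReflection_mulVec]
  cases z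
  · have hs := sum_ite_completing f ξ (Complex.exp (Complex.I * β) * x ξ) (y ξ)
    simp only [Bool.false_eq_true, if_false, ← Finset.mul_sum, mul_div_assoc, hs]
    split_ifs <;> ring
  · simp

lemma groverProduct_mulVec {b c : ℕ} (P : Matrix (Bits b) (Bits b) ℂ)
    (f : Bits b → Bits c → Bool) (δ : ℝ) (l k : ℕ) :
    groverProduct f δ l k *ᵥ (prep c P *ᵥ ketZero b c)
      = fun r : Work b c => if r.2.2 then 0 else
          P r.1 (zeroBits b) * (1 / (Real.sqrt 2 : ℂ)) ^ c *
            (if f r.1 r.2.1 then (iterAmp δ l (completingFraction f r.1) k).1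
              else (iterAmp δ l (completingFraction f r.1) k).2) := by
  induction k with
  | zero =>
    ext r
    simp [groverProduct, prep_mulVec_ketZero, iterAmp]
  | succ k ih =>
    rw [groverProduct, ← Matrix.mulVec_mulVec, ih]
    ext r
    rw [groverIterate_mulVec f _ _ (fun ξ => P ξ (zeroBits b) * (1 / (Real.sqrt 2 : ℂ)) ^ c)
      (fun ξ => (iterAmp δ l (completingFraction f ξ) k).1)
      (fun ξ => (iterAmp δ l (completingFraction f ξ) k).2)]
    rfl

/-- The last oracle call copies `f(ξ, φ)` into the ancilla, so measuring `1` there means that the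
string completes. -/
lemma algA_mulVec_ketZero {b c : ℕ} (P : Matrix (Bits b) (Bits b) ℂ)
    (f : Bits b → Bits c → Bool) (δ : ℝ) (l : ℕ) (r : Work b c) :
    (algA P f δ l *ᵥ ketZero b c) r = if xor r.2.2 (f r.1 r.2.1) then 0 else
          P r.1 (zeroBits b) * (1 / (Real.sqrt 2 : ℂ)) ^ c *
            (if f r.1 r.2.1 then (iterAmp δ l (completingFraction f r.1) l).1
              else (iterAmp δ l (completingFraction f r.1) l).2) := by
  rw [algA, amplification, ← Matrix.mulVec_mulVec, ← Matrix.mulVec_mulVec, oracle_mulVec,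
    groverProduct_mulVec]

/-- The probability that the ancilla of `ψ` is measured to be `1`. -/
def goodProb {b c : ℕ} (ψ : Work b c → ℂ) : ℝ := ∑ r with r.2.2 = true, ‖ψ r‖ ^ 2

lemma goodProb_algA {b c : ℕ} {p : Bits b → ℝ} (hp : ∀ ξ, 0 ≤ p ξ)
    {P : Matrix (Bits b) (Bits b) ℂ} (hP : ∀ ξ, P ξ (zeroBits b) = (Real.sqrt (p ξ) : ℂ))
    (f : Bits b → Bits c → Bool) (δ : ℝ) (l : ℕ) :
    goodProb (algA P f δ l *ᵥ ketZero b c) = ∑ ξ, p ξ * (completingFraction f ξ *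
      ‖(iterAmp δ l (completingFraction f ξ) l).1‖ ^ 2) := by
  rw [goodProb, Finset.sum_filter, Fintype.sum_prod_type]
  apply Finset.sum_congr rfl
  intro ξ _
  rw [Fintype.sum_prod_type]
  have h : ∀ φ : Bits c, (∑ z : Bool, if (ξ, φ, z).2.2 = true then
      ‖(algA P f δ l *ᵥ ketZero b c) (ξ, φ, z)‖ ^ 2 else 0)
      = if f ξ φ = true then p ξ * ((1 / 2 ^ c) *
        ‖(iterAmp δ l (completingFraction f ξ) l).1‖ ^ 2) else 0 := by
    intro φ
    rw [Fintype.sum_bool]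
    simp only [algA_mulVec_ketZero]
    cases hf : f ξ φ
    · simp
    · have h2 : (Real.sqrt 2 ^ c) ^ 2 = 2 ^ c := by
        rw [← pow_mul, mul_comm, pow_mul, Real.sq_sqrt (by norm_num)]
      simp [hP, mul_pow, abs_of_nonneg (Real.sqrt_nonneg _), Real.sq_sqrt (hp ξ), h2]
      ring
  simp only [h]
  rw [← Finset.sum_filter, Finset.sum_const, nsmul_eq_mul, completingFraction]
  ring

lemma completingFraction_nonneg {b c : ℕ} (f : Bits b → Bits c → Bool) (ξ : Bits b) :
    0 ≤ completingFraction f ξ := by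
  unfold completingFraction
  positivity

lemma completingFraction_le_one {b c : ℕ} (f : Bits b → Bits c → Bool) (ξ : Bits b) :
    completingFraction f ξ ≤ 1 := by
  rw [completingFraction, div_le_one (by positivity)]
  have := Finset.card_filter_le (Finset.univ : Finset (Bits c)) (fun φ => f ξ φ = true)
  simp at this
  exact_mod_cast this

lemma completingFraction_eq_zero {b c : ℕ} {f : Bits b → Bits c → Bool} {ξ : Bits b}
    (h : ¬ ∃ φ, f ξ φ = true) : completingFraction f ξ = 0 := by
  push Not at h
  simp [completingFraction, h]

/-- The success probability of the amplified state approximates `μ`. -/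
theorem abs_goodProb_sub_mu_le {b c : ℕ} {p : Bits b → ℝ} (hp : ∀ ξ, 0 ≤ p ξ)
    {P : Matrix (Bits b) (Bits b) ℂ} (hP : ∀ ξ, P ξ (zeroBits b) = (Real.sqrt (p ξ) : ℂ))
    {δ lamT : ℝ} (hδ0 : 0 < δ) (hδ1 : δ ≤ 1) (hlam : 0 < lamT)
    (f : Bits b → Bits c → Bool) :
    |goodProb (algA P f δ (depthT δ lamT / 2) *ᵥ ketZero b c) - mu p f|
      ≤ epsT p f lamT + δ ^ 2 * mu p f - δ ^ 2 * epsT p f lamT := by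
  set l := depthT δ lamT / 2 with hl
  rw [goodProb_algA hp hP]
  set s : Bits b → ℝ := fun ξ => completingFraction f ξ *
      ‖(iterAmp δ l (completingFraction f ξ) l).1‖ ^ 2 with hs
  have hs0 : ∀ ξ, 0 ≤ s ξ := fun ξ =>
    mul_nonneg (completingFraction_nonneg f ξ) (sq_nonneg _)
  have hs1 : ∀ ξ, s ξ ≤ 1 := by
    intro ξ
    have h := iterAmp_norm (δ := δ) l (completingFraction f ξ) l
    have h2 : 0 ≤ (1 - completingFraction f ξ) *
        ‖(iterAmp δ l (completingFraction f ξ) l).2‖ ^ 2 :=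
      mul_nonneg (by linarith [completingFraction_le_one f ξ]) (sq_nonneg _)
    simp only [hs]
    linarith
  have hδ2 : δ ^ 2 ≤ 1 := pow_le_one₀ hδ0.le hδ1
  rw [mu, epsT, Finset.sum_filter, Finset.sum_filter]
  have hup : ∑ ξ, p ξ * s ξ ≤ ∑ ξ, if ∃ φ, f ξ φ = true then p ξ else 0 := by
    apply Finset.sum_le_sum
    intro ξ _
    split_ifs with h
    · exact mul_le_of_le_one_right (hp ξ) (hs1 ξ)
    · simp [hs, completingFraction_eq_zero h]
  -- Scenarios counted by `epsT` contribute at least `0`; the other feasible ones succeed with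
  -- probability at least `1 - δ²`.
  have hlow : (1 - δ ^ 2) * ((∑ ξ, if ∃ φ, f ξ φ = true then p ξ else 0)
      - ∑ ξ, if (∃ φ, f ξ φ = true) ∧ completingFraction f ξ < lamT then p ξ else 0)
        ≤ ∑ ξ, p ξ * s ξ := by
    rw [← Finset.sum_sub_distrib, Finset.mul_sum]
    apply Finset.sum_le_sum
    intro ξ _
    by_cases h : ∃ φ, f ξ φ = true
    · by_cases h2 : completingFraction f ξ < lamT
      · simp only [h, h2, and_self, if_true, sub_self, mul_zero]
        exact mul_nonneg (hp ξ) (hs0 ξ)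
      · have h3 := iterAmp_failure_le hδ0 hδ1 hlam (not_lt.1 h2) (completingFraction_le_one f ξ)
        have h4 := iterAmp_norm (δ := δ) l (completingFraction f ξ) l
        simp only [h, h2, and_false, if_true, if_false, sub_zero]
        rw [mul_comm]
        apply mul_le_mul_of_nonneg_left _ (hp ξ)
        simp only [hs]
        linarith
    · simp only [h, false_and, if_false, sub_self, mul_zero]
      exact mul_nonneg (hp ξ) (hs0 ξ)
  rw [abs_le]
  constructor <;> nlinarith

/-! ### The outcome distribution of phase estimation -/

/-- The factors beyond the first cost at most `u²` times the sum of `1/(2k + 1)²`. This sum is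
dominated by the telescoping sum of `(1/k - 1/(k + 1))/4`, whence the constant `1/4`. -/
lemma le_prod_one_sub_sq_div_odd_sq {u : ℝ} (hu0 : 0 ≤ u) (hu1 : u ≤ 1) (n : ℕ) :
    (1 - u ^ 2) * (1 - u ^ 2 / 4 * (1 - 1 / (n + 1)))
      ≤ ∏ k ∈ Finset.range (n + 1), (1 - u ^ 2 / (2 * (k : ℝ) + 1) ^ 2) := by
  have hu2 : u ^ 2 ≤ 1 := pow_le_one₀ hu0 hu1
  have hu2' : 0 ≤ u ^ 2 := sq_nonneg u
  induction n with
  | zero => simp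
  | succ n ih =>
    rw [Finset.prod_range_succ]
    have hn : (0 : ℝ) ≤ n := Nat.cast_nonneg n
    push_cast
    set A : ℝ := 1 / (n + 1) with hA
    set B : ℝ := 1 / (n + 1 + 1) with hB
    set D : ℝ := 1 / (2 * (n + 1) + 1) ^ 2 with hD
    have hD0 : 0 ≤ D := by positivity
    have hA0 : 0 ≤ A := by positivity
    have hA1 : A ≤ 1 := by rw [hA, div_le_one (by positivity)]; linarith
    have hD1 : D ≤ 1 := by
      rw [hD, div_le_one (by positivity)]
      nlinarith
    have hDAB : D ≤ (A - B) / 4 := by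
      have : (A - B) / 4 = 1 / (4 * (n + 1) * (n + 1 + 1)) := by
        rw [hA, hB]
        field_simp
        ring
      rw [this, hD]
      apply one_div_le_one_div_of_le (by positivity)
      nlinarith
    rw [show u ^ 2 / (2 * ((n : ℝ) + 1) + 1) ^ 2 = u ^ 2 * D by rw [hD]; ring]
    have h1 : 0 ≤ 1 - u ^ 2 * D := by nlinarith
    calc (1 - u ^ 2) * (1 - u ^ 2 / 4 * (1 - B))
        ≤ (1 - u ^ 2) * ((1 - u ^ 2 / 4 * (1 - A)) * (1 - u ^ 2 * D)) := by
          apply mul_le_mul_of_nonneg_left _ (by linarith)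
          have h2 : 0 ≤ u ^ 2 / 4 * (1 - A) * (u ^ 2 * D) :=
            mul_nonneg (mul_nonneg (by positivity) (by linarith)) (by positivity)
          have h3 : u ^ 2 * D ≤ u ^ 2 * ((A - B) / 4) := mul_le_mul_of_nonneg_left hDAB hu2'
          linarith
      _ = (1 - u ^ 2) * (1 - u ^ 2 / 4 * (1 - A)) * (1 - u ^ 2 * D) := by ring
      _ ≤ _ := mul_le_mul_of_nonneg_right ih h1

lemma prod_range_two_mul {M : Type*} [CommMonoid M] (f : ℕ → M) (n : ℕ) :
    ∏ j ∈ Finset.range (2 * n), f j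
      = (∏ k ∈ Finset.range n, f (2 * k)) * ∏ k ∈ Finset.range n, f (2 * k + 1) := by
  induction n with
  | zero => simp
  | succ n ih =>
    rw [show 2 * (n + 1) = 2 * n + 1 + 1 by ring, Finset.prod_range_succ, Finset.prod_range_succ,
      ih, Finset.prod_range_succ, Finset.prod_range_succ]
    ac_rfl

/-- Two factors of the infinite product bound the cosine from below. -/
lemma le_cos_pi_mul_div_two {u : ℝ} (hu0 : 0 ≤ u) (hu1 : u ≤ 1) :
    (1 - u ^ 2) * (1 - u ^ 2 / 4) ≤ Real.cos (Real.pi * (u / 2)) := by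
  rcases hu0.eq_or_lt with rfl | hupos
  · simp
  have hu2 : u ^ 2 ≤ 1 := pow_le_one₀ hu0 hu1
  have hu2' : 0 ≤ u ^ 2 := sq_nonneg u
  have hs : 0 < Real.sin (Real.pi * (u / 2)) := by
    apply Real.sin_pos_of_pos_of_lt_pi
    · positivity
    · nlinarith [Real.pi_pos]
  -- With `2 n` factors, the even denominators in the product for `sin (π u)` reproduce the
  -- `n`-factor product for `sin (π u / 2)`. The odd ones are left for the cosine by the
  -- double-angle formula.
  have h1 := (Real.tendsto_euler_sin_prod u).comp
    (Filter.tendsto_atTop_mono (fun n : ℕ => show n ≤ 2 * n by omega) Filter.tendsto_id)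
  have h2 := (Real.tendsto_euler_sin_prod (u / 2)).const_mul (2 * ((1 - u ^ 2) * (1 - u ^ 2 / 4)))
  have h3 : 2 * ((1 - u ^ 2) * (1 - u ^ 2 / 4)) * Real.sin (Real.pi * (u / 2))
      ≤ Real.sin (Real.pi * u) := by
    refine le_of_tendsto_of_tendsto h2 h1 ?_
    filter_upwards [Filter.eventually_ge_atTop 1] with n hn
    obtain ⟨k, rfl⟩ := Nat.exists_eq_succ_of_ne_zero (by omega : n ≠ 0)
    simp only [Function.comp_apply]
    rw [prod_range_two_mul]
    have ho := le_prod_one_sub_sq_div_odd_sq hu0 hu1 k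
    have e1 : ∏ j ∈ Finset.range (k + 1), (1 - u ^ 2 / (((2 * j : ℕ) : ℝ) + 1) ^ 2)
        = ∏ j ∈ Finset.range (k + 1), (1 - u ^ 2 / (2 * (j : ℝ) + 1) ^ 2) := by
      apply Finset.prod_congr rfl
      intro j _
      push_cast
      rfl
    have e2 : ∏ j ∈ Finset.range (k + 1), (1 - u ^ 2 / (((2 * j + 1 : ℕ) : ℝ) + 1) ^ 2)
        = ∏ j ∈ Finset.range (k + 1), (1 - (u / 2) ^ 2 / ((j : ℝ) + 1) ^ 2) := by
      apply Finset.prod_congr rfl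
      intro j _
      have : (j : ℝ) + 1 ≠ 0 := by positivity
      push_cast
      rw [show (2 * (j : ℝ) + 1 + 1) = 2 * (j + 1) by ring]
      field_simp
    have hE : 0 ≤ ∏ j ∈ Finset.range (k + 1), (1 - (u / 2) ^ 2 / ((j : ℝ) + 1) ^ 2) := by
      apply Finset.prod_nonneg
      intro j _
      have hj : (1 : ℝ) ≤ ((j : ℝ) + 1) ^ 2 := one_le_pow₀ (by linarith [j.cast_nonneg (α := ℝ)])
      have : (u / 2) ^ 2 / ((j : ℝ) + 1) ^ 2 ≤ 1 := by
        rw [div_le_one (by positivity)]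
        nlinarith
      linarith
    simp only [Nat.succ_eq_add_one]
    rw [e1, e2]
    set E := ∏ j ∈ Finset.range (k + 1), (1 - (u / 2) ^ 2 / ((j : ℝ) + 1) ^ 2)
    have hb : (1 - u ^ 2) * (1 - u ^ 2 / 4)
        ≤ ∏ j ∈ Finset.range (k + 1), (1 - u ^ 2 / (2 * (j : ℝ) + 1) ^ 2) := by
      refine le_trans ?_ ho
      apply mul_le_mul_of_nonneg_left _ (by linarith)
      have : 0 ≤ u ^ 2 / 4 * (1 / ((k : ℝ) + 1)) := by positivity
      linarith
    calc 2 * ((1 - u ^ 2) * (1 - u ^ 2 / 4)) * (Real.pi * (u / 2) * E)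
        = (Real.pi * u * E) * ((1 - u ^ 2) * (1 - u ^ 2 / 4)) := by ring
      _ ≤ (Real.pi * u * E) * _ := mul_le_mul_of_nonneg_left hb (by positivity)
      _ = _ := by ring
  rw [show Real.pi * u = 2 * (Real.pi * (u / 2)) by ring, Real.sin_two_mul] at h3
  nlinarith

/-- In the centred variable `u = |2 t - 1|` the sine becomes `cos (π u / 2)`, and the polynomial
lower bound for the cosine suffices. Equality at `t = 1/2` is what makes the constant `8`. -/
lemma eight_mul_le_sin_pi_mul_sq {t : ℝ} (ht0 : 0 ≤ t) (ht1 : t ≤ 1) :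
    8 * (t ^ 2 * (1 - t) ^ 2) ≤ Real.sin (Real.pi * t) ^ 2 * (t ^ 2 + (1 - t) ^ 2) := by
  have key : ∀ u : ℝ, 0 ≤ u → u ≤ 1 →
      (1 - u ^ 2) ^ 2 ≤ Real.cos (Real.pi * (u / 2)) ^ 2 * (1 + u ^ 2) := by
    intro u h0 h1
    have hc := le_cos_pi_mul_div_two h0 h1
    have hu2 : u ^ 2 ≤ 1 := pow_le_one₀ h0 h1
    have hu2' : 0 ≤ u ^ 2 := sq_nonneg u
    have hn : 0 ≤ (1 - u ^ 2) * (1 - u ^ 2 / 4) := mul_nonneg (by linarith) (by linarith)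
    have hsq : ((1 - u ^ 2) * (1 - u ^ 2 / 4)) ^ 2 ≤ Real.cos (Real.pi * (u / 2)) ^ 2 := by
      gcongr
    have hone : 1 ≤ (1 - u ^ 2 / 4) ^ 2 * (1 + u ^ 2) := by
      nlinarith [mul_nonneg hu2' (sub_nonneg.2 hu2), mul_nonneg hu2' (sq_nonneg (u ^ 2))]
    calc (1 - u ^ 2) ^ 2 = (1 - u ^ 2) ^ 2 * 1 := by ring
      _ ≤ (1 - u ^ 2) ^ 2 * ((1 - u ^ 2 / 4) ^ 2 * (1 + u ^ 2)) := by gcongr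
      _ = ((1 - u ^ 2) * (1 - u ^ 2 / 4)) ^ 2 * (1 + u ^ 2) := by ring
      _ ≤ _ := by gcongr
  have hsin : Real.sin (Real.pi * t) = Real.cos (Real.pi * (|2 * t - 1| / 2)) := by
    rcases abs_cases (2 * t - 1) with ⟨h, -⟩ | ⟨h, -⟩ <;> rw [h, ← Real.sin_pi_div_two_sub]
    · rw [← Real.sin_pi_sub]
      congr 1
      ring
    · congr 1
      ring
  have h := key |2 * t - 1| (abs_nonneg _) (by rw [abs_le]; constructor <;> linarith)
  rw [← hsin, sq_abs] at h
  nlinarith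

/-! ### The Fejér kernel and its mass next to the phase -/

/-- The probability that phase estimation with `M` sample points misses the phase by `y`. -/
def fejer (M : ℕ) (y : ℝ) : ℝ :=
  ‖∑ k ∈ Finset.range M, Complex.exp (2 * Complex.I * k * y)‖ ^ 2 / (M : ℝ) ^ 2

lemma fejer_nonneg (M : ℕ) (y : ℝ) : 0 ≤ fejer M y := by
  unfold fejer
  positivity

/-- The geometric sum, with the denominator multiplied out so that zeros of `sin y` are allowed. -/
lemma fejer_mul (M : ℕ) (hM : 0 < M) (y : ℝ) :
    fejer M y * ((M : ℝ) ^ 2 * Real.sin y ^ 2) = Real.sin (M * y) ^ 2 := by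
  have hM' : (M : ℝ) ≠ 0 := by positivity
  have hn : ∀ x : ℝ, ‖Complex.exp (2 * Complex.I * x) - 1‖ ^ 2 = 4 * Real.sin x ^ 2 := by
    intro x
    have h1 := Real.cos_two_mul x
    have h2 := Real.sin_sq_add_cos_sq x
    have h3 := Real.sin_sq_add_cos_sq (2 * x)
    rw [show 2 * Complex.I * (x : ℂ) = ((2 * x : ℝ) : ℂ) * Complex.I by push_cast; ring,
      Complex.sq_norm, Complex.normSq_apply, Complex.sub_re, Complex.sub_im,
      Complex.exp_ofReal_mul_I_re, Complex.exp_ofReal_mul_I_im, Complex.one_re, Complex.one_im]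
    linear_combination h3 - 2 * h1 - 4 * h2
  have hg : (∑ k ∈ Finset.range M, Complex.exp (2 * Complex.I * k * y))
      * (Complex.exp (2 * Complex.I * y) - 1) = Complex.exp (2 * Complex.I * (M * y : ℝ)) - 1 := by
    have := geom_sum_mul (Complex.exp (2 * Complex.I * y)) M
    rw [← Complex.exp_nat_mul] at this
    convert this using 3
    · rw [← Complex.exp_nat_mul]
      congr 1
      ring
    · push_cast
      ring
  have h := congrArg (fun z => ‖z‖ ^ 2) hg
  simp only [norm_mul, mul_pow, hn] at h
  rw [fejer]
  field_simp
  linarith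

lemma fejer_zero {M : ℕ} (hM : 0 < M) : fejer M 0 = 1 := by
  simp [fejer, hM.ne']

lemma fejer_add_int_mul_pi (M : ℕ) (y : ℝ) (n : ℤ) : fejer M (y + n * Real.pi) = fejer M y := by
  unfold fejer
  congr 3
  apply Finset.sum_congr rfl
  intro k _
  rw [Complex.exp_eq_exp_iff_exists_int]
  exact ⟨k * n, by push_cast; ring⟩

lemma fejer_neg (M : ℕ) (y : ℝ) : fejer M (-y) = fejer M y := by
  unfold fejer
  congr 2
  rw [← Complex.norm_conj, map_sum]
  congr 1
  apply Finset.sum_congr rfl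
  intro k _
  rw [← Complex.exp_conj]
  congr 1
  simp [Complex.conj_ofNat]

lemma sinc_sq_le_fejer {M : ℕ} (hM : 0 < M) {r : ℝ} (hr0 : 0 < r) (hr1 : r < Real.pi) :
    Real.sin (M * r) ^ 2 / (M * r) ^ 2 ≤ fejer M r := by
  have hs := Real.sin_pos_of_pos_of_lt_pi hr0 hr1
  have hM' : (0 : ℝ) < M := by exact_mod_cast hM
  rw [← fejer_mul M hM r, div_le_iff₀ (by positivity), mul_pow]
  have : Real.sin r ^ 2 ≤ r ^ 2 := by
    gcongr
    exact Real.sin_le hr0.le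
  have h0 := fejer_nonneg M r
  gcongr

lemma eight_div_pi_sq_le_one : 8 / Real.pi ^ 2 ≤ 1 := by
  rw [div_le_one (by positivity)]
  nlinarith [Real.pi_gt_three]

/-- The two outcomes next to the phase have total probability at least `8 / π²`. -/
theorem eight_div_pi_sq_le_sum_fejer {M : ℕ} (hM : 0 < M) (θ : ℝ) :
    8 / Real.pi ^ 2 ≤ ∑ d ∈ Finset.univ.filter (fun d : Fin M =>
      |Real.sin (θ - Real.pi * ((d : ℕ) : ℝ) / M)| ≤ Real.pi / M),
        fejer M (θ - Real.pi * (d : ℕ) / M) := by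
  have hM' : (0 : ℝ) < M := by exact_mod_cast hM
  have hpi := Real.pi_pos
  set S : Finset (Fin M) := Finset.univ.filter fun d : Fin M =>
    |Real.sin (θ - Real.pi * ((d : ℕ) : ℝ) / M)| ≤ Real.pi / M with hS
  -- Changing `n` by a multiple of `M` moves the argument by a multiple of `π`, so any integer grid
  -- point may be reduced modulo `M` to an outcome.
  have hrep : ∀ n : ℤ, ∃ d : Fin M, ((d : ℕ) : ℤ) = n % M ∧
      fejer M (θ - Real.pi * (d : ℕ) / M) = fejer M (θ - Real.pi * n / M) ∧
      |Real.sin (θ - Real.pi * (d : ℕ) / M)| = |Real.sin (θ - Real.pi * n / M)| := by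
    intro n
    have h0 : 0 ≤ n % M := Int.emod_nonneg _ (by omega)
    have h1 : n % M < M := Int.emod_lt_of_pos _ (by omega)
    refine ⟨⟨(n % M).toNat, by omega⟩, by simp [h0], ?_⟩
    have h2 : (((n % M).toNat : ℕ) : ℝ) = n - M * (n / M : ℤ) := by
      have h3 : (((n % M).toNat : ℕ) : ℤ) = n - M * (n / M) := by
        rw [Int.toNat_of_nonneg h0, Int.emod_def]
      exact_mod_cast h3
    have h4 : θ - Real.pi * ((n % M).toNat : ℕ) / M
        = θ - Real.pi * n / M + (n / M : ℤ) * Real.pi := by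
      rw [h2]
      field_simp
      ring
    simp only [h4]
    refine ⟨fejer_add_int_mul_pi _ _ _, ?_⟩
    rw [Real.sin_add_int_mul_pi, abs_mul]
    simp
  set n : ℤ := ⌊M * θ / Real.pi⌋ with hn
  set r := θ - Real.pi * n / M with hr
  have hr0 : 0 ≤ r := by
    have := Int.floor_le (M * θ / Real.pi)
    rw [le_div_iff₀ hpi] at this
    rw [hr, sub_nonneg, div_le_iff₀ hM']
    linarith
  have hr1 : r < Real.pi / M := by
    have := Int.lt_floor_add_one (M * θ / Real.pi)
    rw [div_lt_iff₀ hpi] at this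
    rw [hr, sub_lt_iff_lt_add, ← add_div, lt_div_iff₀ hM']
    linarith
  obtain ⟨d0, hd0, hf0, hs0⟩ := hrep n
  obtain ⟨d1, hd1, hf1, hs1⟩ := hrep (n + 1)
  have hr' : θ - Real.pi * ((n + 1 : ℤ) : ℝ) / M = -(Real.pi / M - r) := by
    rw [hr]
    push_cast
    ring
  rw [hr', fejer_neg] at hf1
  rw [hr', Real.sin_neg, abs_neg] at hs1
  rw [← hr] at hf0 hs0
  have hm0 : d0 ∈ S := by
    rw [hS, Finset.mem_filter]
    refine ⟨Finset.mem_univ _, ?_⟩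
    rw [hs0]
    exact (Real.abs_sin_le_abs).trans (by rw [abs_of_nonneg hr0]; exact hr1.le)
  have hm1 : d1 ∈ S := by
    rw [hS, Finset.mem_filter]
    refine ⟨Finset.mem_univ _, ?_⟩
    rw [hs1]
    exact (Real.abs_sin_le_abs).trans (by rw [abs_of_nonneg (by linarith)]; linarith)
  have hsingle : fejer M r ≤ ∑ d ∈ S, fejer M (θ - Real.pi * (d : ℕ) / M) := by
    rw [← hf0]
    exact Finset.single_le_sum (f := fun d : Fin M => fejer M (θ - Real.pi * (d : ℕ) / M))
      (fun d _ => fejer_nonneg _ _) hm0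
  -- When the phase is on the grid, or `M = 1`, a single outcome has kernel value `1`. Otherwise
  -- both neighbours are at positive distance and distinct modulo `M`.
  rcases hr0.eq_or_lt with h0 | hrpos
  · rw [← h0, fejer_zero hM] at hsingle
    exact eight_div_pi_sq_le_one.trans hsingle
  rcases Nat.lt_or_ge M 2 with h2 | h2
  · obtain rfl : M = 1 := by omega
    have : fejer 1 r = 1 := by simp [fejer]
    rw [this] at hsingle
    exact eight_div_pi_sq_le_one.trans hsingle
  have hne : d0 ≠ d1 := by
    rintro rfl
    rw [hd0] at hd1
    have h3 : ((M : ℕ) : ℤ) ∣ (n + 1) - n := Int.ModEq.dvd hd1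
    rw [add_sub_cancel_left] at h3
    have := Int.le_of_dvd one_pos h3
    omega
  have hpair : fejer M r + fejer M (Real.pi / M - r)
      ≤ ∑ d ∈ S, fejer M (θ - Real.pi * (d : ℕ) / M) := by
    rw [← hf0, ← hf1, ← Finset.sum_pair hne
      (f := fun d : Fin M => fejer M (θ - Real.pi * (d : ℕ) / M))]
    apply Finset.sum_le_sum_of_subset_of_nonneg
    · intro d hd
      rcases Finset.mem_insert.1 hd with rfl | hd
      · exact hm0
      · rw [Finset.mem_singleton.1 hd]; exact hm1
    · exact fun d _ _ => fejer_nonneg _ _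
  refine le_trans ?_ hpair
  have hlt : Real.pi / M < Real.pi := by
    rw [div_lt_iff₀ hM']
    have : (2 : ℝ) ≤ M := by exact_mod_cast h2
    nlinarith
  have b0 := sinc_sq_le_fejer hM hrpos (by linarith)
  have b1 := sinc_sq_le_fejer hM (r := Real.pi / M - r) (by linarith) (by linarith)
  refine le_trans ?_ (add_le_add b0 b1)
  set t := M * r / Real.pi with ht
  have ht0 : 0 < t := by positivity
  have ht1 : t < 1 := by
    rw [ht, div_lt_one hpi]
    rwa [lt_div_iff₀ hM', mul_comm] at hr1
  have e0 : M * r = Real.pi * t := by rw [ht]; field_simp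
  have e1 : M * (Real.pi / M - r) = Real.pi * (1 - t) := by
    rw [mul_sub, e0]
    field_simp
  have e2 : Real.sin (Real.pi * (1 - t)) = Real.sin (Real.pi * t) := by
    rw [mul_sub, mul_one, Real.sin_pi_sub]
  rw [e0, e1, e2]
  have hk := eight_mul_le_sin_pi_mul_sq ht0.le ht1.le
  have ht1' : 0 < 1 - t := by linarith
  have e3 : Real.sin (Real.pi * t) ^ 2 / (Real.pi * t) ^ 2
      + Real.sin (Real.pi * t) ^ 2 / (Real.pi * (1 - t)) ^ 2
      = (Real.sin (Real.pi * t) ^ 2 * (t ^ 2 + (1 - t) ^ 2)) / (t ^ 2 * (1 - t) ^ 2)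
        / Real.pi ^ 2 := by
    field_simp
    ring
  rw [e3]
  gcongr
  rwa [le_div_iff₀ (by positivity)]

/-! ### Unitarity -/

lemma diagonal_mem_unitaryGroup {n : Type*} [Fintype n] [DecidableEq n] {d : n → ℂ}
    (h : ∀ i, ‖d i‖ = 1) : Matrix.diagonal d ∈ Matrix.unitaryGroup n ℂ := by
  rw [Matrix.mem_unitaryGroup_iff, Matrix.star_eq_conjTranspose, Matrix.diagonal_conjTranspose,
    Matrix.diagonal_mul_diagonal, ← Matrix.diagonal_one]
  congr 1
  ext i
  simp [Complex.mul_conj, Complex.normSq_eq_norm_sq, h i]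

lemma neg_mem_unitaryGroup {n : Type*} [Fintype n] [DecidableEq n] {U : Matrix n n ℂ}
    (h : U ∈ Matrix.unitaryGroup n ℂ) : -U ∈ Matrix.unitaryGroup n ℂ := by
  rw [Matrix.mem_unitaryGroup_iff] at h ⊢
  simpa using h

lemma conjTranspose_oracle {b c : ℕ} (f : Bits b → Bits c → Bool) : (oracle f)ᴴ = oracle f := by
  ext ⟨ξ, φ, z⟩ ⟨ξ', φ', z'⟩
  simp only [oracle, Matrix.conjTranspose_apply, Matrix.of_apply, Prod.mk.injEq]
  have : (ξ' = ξ ∧ φ' = φ ∧ z' = xor z (f ξ φ)) ↔ (ξ = ξ' ∧ φ = φ' ∧ z = xor z' (f ξ' φ')) := by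
    constructor <;> rintro ⟨rfl, rfl, rfl⟩ <;> simp
  simp only [this]
  split_ifs <;> simp

lemma oracle_mul_self {b c : ℕ} (f : Bits b → Bits c → Bool) : oracle f * oracle f = 1 := by
  apply Matrix.ext_of_mulVec_single
  intro i
  ext r
  rw [← Matrix.mulVec_mulVec, oracle_mulVec, oracle_mulVec, Matrix.one_mulVec]
  simp

lemma oracle_mem_unitaryGroup {b c : ℕ} (f : Bits b → Bits c → Bool) :
    oracle f ∈ Matrix.unitaryGroup (Work b c) ℂ := by
  rw [Matrix.mem_unitaryGroup_iff, Matrix.star_eq_conjTranspose, conjTranspose_oracle,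
    oracle_mul_self]

lemma ancillaPhase_mem_unitaryGroup (b c : ℕ) (β : ℝ) :
    ancillaPhase b c β ∈ Matrix.unitaryGroup (Work b c) ℂ := by
  apply diagonal_mem_unitaryGroup
  intro r
  split_ifs
  · rw [mul_comm, Complex.norm_exp_ofReal_mul_I]
  · simp

lemma zeroReflection_mem_unitaryGroup (b c : ℕ) :
    zeroReflection b c ∈ Matrix.unitaryGroup (Work b c) ℂ := by
  apply diagonal_mem_unitaryGroup
  intro r
  split_ifs <;> simp

lemma negAncillaZ_mem_unitaryGroup (b c : ℕ) :
    negAncillaZ b c ∈ Matrix.unitaryGroup (Work b c) ℂ := by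
  apply diagonal_mem_unitaryGroup
  intro r
  split_ifs <;> simp

lemma plusProj_mul_self (c : ℕ) : plusProj c * plusProj c = plusProj c := by
  ext s t
  simp [plusProj, Matrix.mul_apply]

lemma conjTranspose_plusProj (c : ℕ) : (plusProj c)ᴴ = plusProj c := by
  ext s t
  simp [plusProj]

lemma plusReflection_mem_unitaryGroup (b c : ℕ) (α : ℝ) :
    plusReflection b c α ∈ Matrix.unitaryGroup (Work b c) ℂ := by
  rw [Matrix.mem_unitaryGroup_iff, Matrix.star_eq_conjTranspose, plusReflection]
  set R : Matrix (Work b c) (Work b c) ℂ :=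
    (1 : Matrix (Bits b) (Bits b) ℂ) ⊗ₖ (plusProj c ⊗ₖ (1 : Matrix Bool Bool ℂ)) with hR
  have h1 : R * R = R := by
    rw [hR, ← Matrix.mul_kronecker_mul, ← Matrix.mul_kronecker_mul, plusProj_mul_self]
    simp
  have h2 : Rᴴ = R := by
    rw [hR, Matrix.conjTranspose_kronecker, Matrix.conjTranspose_kronecker, conjTranspose_plusProj]
    simp
  set ζ := Complex.exp (-(Complex.I * α)) with hζ
  have h3 : ζ * star ζ = 1 := by
    have : ‖ζ‖ = 1 := by
      rw [hζ, ← mul_neg, ← Complex.ofReal_neg, mul_comm, Complex.norm_exp_ofReal_mul_I]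
    simp [Complex.mul_conj, Complex.normSq_eq_norm_sq, this]
  rw [Matrix.conjTranspose_sub, Matrix.conjTranspose_smul, h2, Matrix.conjTranspose_one, sub_mul,
    mul_sub, mul_sub, one_mul, one_mul, mul_one, smul_mul_smul_comm, h1]
  have h4 : (1 - ζ) * star (1 - ζ) = (1 - ζ) + star (1 - ζ) := by
    rw [star_sub, star_one]
    linear_combination h3
  rw [h4, add_smul]
  abel

lemma hadamardBit_mul_star (s t : Bool) :
    ∑ x, hadamardBit s x * star (hadamardBit t x) = if s = t then 1 else 0 := by
  have h : (Real.sqrt 2 : ℂ) * (Real.sqrt 2 : ℂ) = 2 := by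
    exact_mod_cast Real.mul_self_sqrt (by norm_num : (0 : ℝ) ≤ 2)
  have h0 : (Real.sqrt 2 : ℂ) ≠ 0 := by
    intro h0
    simp [h0] at h
  cases s <;> cases t <;> simp [hadamardBit] <;> field_simp <;> rw [pow_two, h] <;> norm_num

lemma hadamard_mem_unitaryGroup (c : ℕ) : hadamard c ∈ Matrix.unitaryGroup (Bits c) ℂ := by
  rw [Matrix.mem_unitaryGroup_iff, Matrix.star_eq_conjTranspose]
  ext s t
  rw [Matrix.mul_apply, Matrix.one_apply]
  simp only [Matrix.conjTranspose_apply, hadamard, Matrix.of_apply, star_prod,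
    ← Finset.prod_mul_distrib]
  have h := Finset.prod_univ_sum (fun _ : Fin c => (Finset.univ : Finset Bool))
    (fun i x => hadamardBit (s i) x * star (hadamardBit (t i) x))
  rw [Fintype.piFinset_univ] at h
  rw [← h]
  simp only [hadamardBit_mul_star]
  by_cases hst : s = t
  · simp [hst]
  · rw [if_neg hst]
    obtain ⟨i, hi⟩ := Function.ne_iff.1 hst
    exact Finset.prod_eq_zero (Finset.mem_univ i) (if_neg hi)

lemma prep_mem_unitaryGroup {b : ℕ} (c : ℕ) {P : Matrix (Bits b) (Bits b) ℂ}
    (hP : P ∈ Matrix.unitaryGroup (Bits b) ℂ) :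
    prep c P ∈ Matrix.unitaryGroup (Work b c) ℂ :=
  Matrix.kronecker_mem_unitary hP
    (Matrix.kronecker_mem_unitary (hadamard_mem_unitaryGroup c) (one_mem _))

lemma groverProduct_mem_unitaryGroup {b c : ℕ} (f : Bits b → Bits c → Bool) (δ : ℝ) (l k : ℕ) :
    groverProduct f δ l k ∈ Matrix.unitaryGroup (Work b c) ℂ := by
  induction k with
  | zero => exact one_mem _
  | succ k ih =>
    refine mul_mem (neg_mem_unitaryGroup (mul_mem (plusReflection_mem_unitaryGroup _ _ _) ?_)) ih
    exact mul_mem (mul_mem (oracle_mem_unitaryGroup f) (ancillaPhase_mem_unitaryGroup _ _ _))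
      (oracle_mem_unitaryGroup f)

lemma algA_mem_unitaryGroup {b c : ℕ} {P : Matrix (Bits b) (Bits b) ℂ}
    (hP : P ∈ Matrix.unitaryGroup (Bits b) ℂ) (f : Bits b → Bits c → Bool) (δ : ℝ) (l : ℕ) :
    algA P f δ l ∈ Matrix.unitaryGroup (Work b c) ℂ :=
  mul_mem (mul_mem (oracle_mem_unitaryGroup f) (groverProduct_mem_unitaryGroup f δ l l))
    (prep_mem_unitaryGroup c hP)

lemma qft_mem_unitaryGroup (m : ℕ) : qft m ∈ Matrix.unitaryGroup (Fin (2 ^ m)) ℂ := by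
  rw [Matrix.mem_unitaryGroup_iff, Matrix.star_eq_conjTranspose]
  ext d e
  rw [Matrix.mul_apply, Matrix.one_apply]
  have hM : ((2 : ℂ) ^ m) ≠ 0 := pow_ne_zero _ two_ne_zero
  have hs : (Real.sqrt (2 ^ m) : ℂ) * (Real.sqrt (2 ^ m) : ℂ) = 2 ^ m := by
    exact_mod_cast Real.mul_self_sqrt (by positivity : (0 : ℝ) ≤ 2 ^ m)
  set z : ℂ := Complex.exp (2 * Real.pi * Complex.I * ((d : ℕ) - (e : ℕ)) / 2 ^ m) with hz
  have hterm : ∀ k : Fin (2 ^ m), qft m d k * (qft m)ᴴ k e = z ^ (k : ℕ) / 2 ^ m := by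
    intro k
    rw [Matrix.conjTranspose_apply]
    simp only [qft, Matrix.of_apply]
    rw [star_div₀, ← starRingEnd_apply, ← starRingEnd_apply, ← Complex.exp_conj,
      Complex.conj_ofReal, div_mul_div_comm, hs, ← Complex.exp_add, hz, ← Complex.exp_nat_mul]
    congr 2
    simp [Complex.conj_ofNat]
    ring
  simp only [hterm]
  rw [← Finset.sum_div, Fin.sum_univ_eq_sum_range (fun k => z ^ k) (2 ^ m)]
  split_ifs with hde
  · have : z = 1 := by simp [hz, hde]
    simp [this]
  · have hz1 : z ≠ 1 := by
      intro h1
      obtain ⟨n, hn⟩ := Complex.exp_eq_one_iff.1 h1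
      have hpi : (2 * Real.pi * Complex.I : ℂ) ≠ 0 := Complex.two_pi_I_ne_zero
      have h2 : ((d : ℕ) : ℂ) - (e : ℕ) = n * 2 ^ m := by
        apply mul_left_cancel₀ hpi
        rw [div_eq_iff hM] at hn
        linear_combination hn
      have h3 : ((d : ℕ) : ℤ) - (e : ℕ) = n * 2 ^ m := by exact_mod_cast h2
      have hd : ((d : ℕ) : ℤ) < 2 ^ m := by exact_mod_cast d.2
      have he : ((e : ℕ) : ℤ) < 2 ^ m := by exact_mod_cast e.2
      have hd0 : (0 : ℤ) ≤ (d : ℕ) := by positivity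
      have he0 : (0 : ℤ) ≤ (e : ℕ) := by positivity
      have hn0 : n = 0 := by
        by_contra hne
        rcases lt_or_gt_of_ne hne with h | h
        · nlinarith
        · nlinarith
      rw [hn0, zero_mul, sub_eq_zero] at h3
      exact hde (Fin.ext (by exact_mod_cast h3))
    have hzM : z ^ 2 ^ m = 1 := by
      rw [hz, ← Complex.exp_nat_mul, Complex.exp_eq_one_iff]
      refine ⟨(d : ℕ) - (e : ℕ), ?_⟩
      push_cast
      field_simp
    have hg := geom_sum_mul z (2 ^ m)
    rw [hzM, sub_self] at hg
    rcases mul_eq_zero.1 hg with h | h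
    · rw [h, zero_div]
    · exact absurd (sub_eq_zero.1 h) hz1

/-! ### Amplitude estimation -/

lemma sum_norm_sq_algA {b c : ℕ} {P : Matrix (Bits b) (Bits b) ℂ}
    (hP : P ∈ Matrix.unitaryGroup (Bits b) ℂ) (f : Bits b → Bits c → Bool) (δ : ℝ) (l : ℕ) :
    ∑ r, ‖(algA P f δ l *ᵥ ketZero b c) r‖ ^ 2 = 1 := by
  have hA := Matrix.mem_unitaryGroup_iff'.1 (algA_mem_unitaryGroup hP f δ l)
  have h := congrFun (congrFun hA (zeroWork b c)) (zeroWork b c)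
  rw [Matrix.mul_apply, Matrix.one_apply_eq] at h
  have h2 : ((∑ r, ‖(algA P f δ l *ᵥ ketZero b c) r‖ ^ 2 : ℝ) : ℂ) = 1 := by
    rw [← h]
    push_cast
    apply Finset.sum_congr rfl
    intro r _
    rw [ketZero, Matrix.mulVec_single_one, Matrix.col_apply, Matrix.star_apply, mul_comm,
      ← starRingEnd_apply, Complex.mul_conj, Complex.normSq_eq_norm_sq]
    push_cast
    rfl
  exact_mod_cast h2

lemma zeroReflection_mulVec {b c : ℕ} (v : Work b c → ℂ) :
    zeroReflection b c *ᵥ v = v - (2 * v (zeroWork b c)) • ketZero b c := by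
  ext r
  rw [zeroReflection, Matrix.mulVec_diagonal]
  by_cases h : r = zeroWork b c
  · subst h
    simp [ketZero]
    ring
  · simp [h, ketZero]

/-- Since `A` is unitary, `A (I - 2|0⟩⟨0|) A†` is the reflection in `A|0⟩`. Thus `Q` acts by scalars
on the good and bad parts, and the inner product with `A|0⟩` only involves `goodProb`. -/
lemma algQ_mulVec {b c : ℕ} {P : Matrix (Bits b) (Bits b) ℂ}
    (hP : P ∈ Matrix.unitaryGroup (Bits b) ℂ) (f : Bits b → Bits c → Bool) (δ : ℝ) (l : ℕ)
    (x y : ℂ) :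
    (algQ P f δ l *ᵥ fun r => (if r.2.2 then x else y) * (algA P f δ l *ᵥ ketZero b c) r)
      = fun r => ((if r.2.2 then x else -y)
          - 2 * (x * goodProb (algA P f δ l *ᵥ ketZero b c)
            - y * (1 - goodProb (algA P f δ l *ᵥ ketZero b c))))
          * (algA P f δ l *ᵥ ketZero b c) r := by
  have hA := Matrix.mem_unitaryGroup_iff.1 (algA_mem_unitaryGroup hP f δ l)
  rw [Matrix.star_eq_conjTranspose] at hA
  have hnorm := sum_norm_sq_algA hP f δ l
  have hcol : ∀ r, algA P f δ l r (zeroWork b c) = (algA P f δ l *ᵥ ketZero b c) r := by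
    intro r
    rw [ketZero, Matrix.mulVec_single_one, Matrix.col_apply]
  set A := algA P f δ l
  set ψ := A *ᵥ ketZero b c with hψ
  have hsplit : ∀ u v : ℂ, ∑ r : Work b c, (if r.2.2 then u else v) * (‖ψ r‖ ^ 2 : ℝ)
      = u * goodProb ψ + v * (1 - goodProb ψ) := by
    intro u v
    have h1 : (1 : ℂ) - goodProb ψ = ((∑ r with ¬ r.2.2 = true, ‖ψ r‖ ^ 2 : ℝ) : ℂ) := by
      rw [← Complex.ofReal_one, ← hnorm, goodProb,
        ← Finset.sum_filter_add_sum_filter_not Finset.univ (fun r : Work b c => r.2.2 = true)]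
      push_cast
      ring
    rw [h1, goodProb]
    push_cast
    rw [Finset.mul_sum, Finset.mul_sum, Finset.sum_filter, Finset.sum_filter,
      ← Finset.sum_add_distrib]
    apply Finset.sum_congr rfl
    rintro ⟨ξ, φ, z⟩ _
    cases z <;> simp
  rw [algQ, ← Matrix.mulVec_mulVec, ← Matrix.mulVec_mulVec, ← Matrix.mulVec_mulVec]
  have hN : (negAncillaZ b c *ᵥ fun r => (if r.2.2 then x else y) * ψ r)
      = fun r => (if r.2.2 then x else -y) * ψ r := by
    ext ⟨ξ, φ, z⟩
    rw [negAncillaZ, Matrix.mulVec_diagonal]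
    cases z <;> simp
  have h0 : (Aᴴ *ᵥ fun r => (if r.2.2 then x else -y) * ψ r) (zeroWork b c)
      = x * goodProb ψ - y * (1 - goodProb ψ) := by
    rw [sub_eq_add_neg, ← neg_mul, ← hsplit, Matrix.mulVec, dotProduct]
    apply Finset.sum_congr rfl
    intro r _
    rw [Matrix.conjTranspose_apply, hcol, mul_left_comm, ← starRingEnd_apply, mul_comm _ (ψ r),
      Complex.mul_conj, Complex.normSq_eq_norm_sq]
  rw [hN, zeroReflection_mulVec, Matrix.mulVec_sub, Matrix.mulVec_mulVec, hA, Matrix.one_mulVec,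
    Matrix.mulVec_smul, h0, ← hψ]
  ext r
  simp only [Pi.sub_apply, Pi.smul_apply, smul_eq_mul]
  ring

/-- The powers of `Q` rotate `A|0⟩` in the plane of its good and bad parts. -/
lemma algQ_pow_mulVec {b c : ℕ} {P : Matrix (Bits b) (Bits b) ℂ}
    (hP : P ∈ Matrix.unitaryGroup (Bits b) ℂ) (f : Bits b → Bits c → Bool) (δ : ℝ) (l : ℕ)
    {θ : ℝ} (hθ : goodProb (algA P f δ l *ᵥ ketZero b c) = Real.sin θ ^ 2) (k : ℕ) :
    ∃ s t : ℝ, Real.sin θ * s = Real.sin ((2 * k + 1) * θ) ∧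
      Real.cos θ * t = Real.cos ((2 * k + 1) * θ) ∧
      (algQ P f δ l) ^ k *ᵥ (algA P f δ l *ᵥ ketZero b c)
        = fun r => (if r.2.2 then (s : ℂ) else t) * (algA P f δ l *ᵥ ketZero b c) r := by
  induction k with
  | zero => exact ⟨1, 1, by simp, by simp, by ext r; simp⟩
  | succ k ih =>
    obtain ⟨s, t, hs, ht, hq⟩ := ih
    have hsc := Real.sin_sq_add_cos_sq θ
    have hs' : (1 : ℝ) - Real.sin θ ^ 2 = Real.cos θ ^ 2 := by linarith
    have e : (2 * ((k + 1 : ℕ) : ℝ) + 1) * θ = (2 * k + 1) * θ + 2 * θ := by push_cast; ring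
    -- The multipliers come from `algQ_mulVec`. Relating them to the angle through products with
    -- `sin θ` and `cos θ` avoids division when one part vanishes.
    refine ⟨s - 2 * (s * Real.sin θ ^ 2 - t * Real.cos θ ^ 2),
      -t - 2 * (s * Real.sin θ ^ 2 - t * Real.cos θ ^ 2), ?_, ?_, ?_⟩
    · rw [e, Real.sin_add, ← hs, ← ht, Real.cos_two_mul, Real.sin_two_mul]
      linear_combination (-2 * Real.sin θ * s) * hsc
    · rw [e, Real.cos_add, ← hs, ← ht, Real.cos_two_mul, Real.sin_two_mul]
      ring
    · rw [pow_succ', ← Matrix.mulVec_mulVec, hq, algQ_mulVec hP, hθ]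
      ext ⟨ξ, φ, z⟩
      rw [← Complex.ofReal_one, ← Complex.ofReal_sub, hs']
      cases z <;> simp

/-- The binary digits of `d` select the powers `2 ^ j`; together they give `U ^ d` once `k` reaches
`m`. -/
lemma prod_controlledPower {b c : ℕ} (m : ℕ) (U : Matrix (Work b c) (Work b c) ℂ) (k : ℕ) :
    ((List.range k).map (controlledPower m U)).prod
      = Matrix.blockDiagonal fun d : Fin (2 ^ m) => U ^ ((d : ℕ) % 2 ^ k) := by
  induction k with
  | zero =>
    simp only [List.range_zero, List.map_nil, List.prod_nil, pow_zero, Nat.mod_one]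
    exact Matrix.blockDiagonal_one.symm
  | succ k ih =>
    rw [List.range_succ, List.map_append, List.prod_append, ih]
    simp only [List.map_cons, List.map_nil, List.prod_cons, List.prod_nil, mul_one]
    rw [controlledPower, ← Matrix.blockDiagonal_mul]
    congr 1
    ext1 d
    have h : (d : ℕ) % 2 ^ (k + 1) = (d : ℕ) % 2 ^ k + 2 ^ k * ((d : ℕ).testBit k).toNat := by
      rw [Nat.mod_pow_succ, Nat.toNat_testBit]
    rw [h, pow_add]
    cases (d : ℕ).testBit k <;> simp

/-- The state of amplitude estimation, one amplitude at a time. -/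
lemma estimationState_apply {b c : ℕ} (m : ℕ) (P : Matrix (Bits b) (Bits b) ℂ)
    (f : Bits b → Bits c → Bool) (δ : ℝ) (l : ℕ) (r : Work b c) (d : Fin (2 ^ m)) :
    estimationState m P f δ l (r, d)
      = (∑ k ∈ Finset.range (2 ^ m),
        Complex.exp (-(2 * Complex.I * k * (Real.pi * (d : ℕ) / 2 ^ m)))
          * (algQ P f δ l ^ k *ᵥ (algA P f δ l *ᵥ ketZero b c)) r) / 2 ^ m := by
  set ψ := algA P f δ l *ᵥ ketZero b c with hψ
  have hs : (Real.sqrt (2 ^ m) : ℂ) * (Real.sqrt (2 ^ m) : ℂ) = 2 ^ m := by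
    exact_mod_cast Real.mul_self_sqrt (by positivity : (0 : ℝ) ≤ 2 ^ m)
  rw [estimationState, ← hψ, prod_controlledPower]
  have h1 : ∀ (r : Work b c) (k : Fin (2 ^ m)),
      ((Matrix.blockDiagonal fun d : Fin (2 ^ m) => algQ P f δ l ^ ((d : ℕ) % 2 ^ m)) *ᵥ
        fun r : Reg b c m => ψ r.1 * (1 / (Real.sqrt (2 ^ m) : ℂ))) (r, k)
        = (algQ P f δ l ^ (k : ℕ) *ᵥ ψ) r * (1 / (Real.sqrt (2 ^ m) : ℂ)) := by
    intro r k
    rw [Matrix.mulVec, dotProduct, Fintype.sum_prod_type, Matrix.mulVec, dotProduct,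
      Finset.sum_mul]
    apply Finset.sum_congr rfl
    intro r' _
    simp only [Matrix.blockDiagonal_apply, ite_mul, zero_mul]
    rw [Finset.sum_ite_eq, if_pos (Finset.mem_univ _), Nat.mod_eq_of_lt k.2, mul_assoc]
  rw [Matrix.mulVec, dotProduct, Fintype.sum_prod_type]
  simp only [h1, Matrix.kroneckerMap_apply, Matrix.one_apply, ite_mul, one_mul, zero_mul]
  rw [Finset.sum_comm]
  simp only [Finset.sum_ite_eq, Finset.mem_univ, if_true]
  rw [← Fin.sum_univ_eq_sum_range (fun k => Complex.exp (-(2 * Complex.I * k *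
    (Real.pi * (d : ℕ) / 2 ^ m))) * (algQ P f δ l ^ k *ᵥ ψ) r), Finset.sum_div]
  apply Finset.sum_congr rfl
  intro k _
  rw [Matrix.conjTranspose_apply]
  simp only [qft, Matrix.of_apply]
  rw [star_div₀, ← starRingEnd_apply, ← starRingEnd_apply, ← Complex.exp_conj,
    Complex.conj_ofReal, mul_one_div, div_mul_div_comm, hs]
  congr 3
  simp [Complex.conj_ofNat]
  ring

/-- The outcome distribution of amplitude estimation. -/
lemma outcomeProb_estimationState {b c : ℕ} (m : ℕ) {P : Matrix (Bits b) (Bits b) ℂ}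
    (hP : P ∈ Matrix.unitaryGroup (Bits b) ℂ) (f : Bits b → Bits c → Bool) (δ : ℝ) (l : ℕ)
    {θ : ℝ} (hθ : goodProb (algA P f δ l *ᵥ ketZero b c) = Real.sin θ ^ 2) (d : Fin (2 ^ m)) :
    outcomeProb (estimationState m P f δ l) d
      = (fejer (2 ^ m) (θ - Real.pi * (d : ℕ) / (2 ^ m : ℕ))
        + fejer (2 ^ m) (-θ - Real.pi * (d : ℕ) / (2 ^ m : ℕ))) / 2 := by
  choose s t hs ht hq using algQ_pow_mulVec hP f δ l hθ
  have hnorm := sum_norm_sq_algA hP f δ l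
  set ψ := algA P f δ l *ᵥ ketZero b c with hψ
  have hMpos : (0 : ℝ) < (2 ^ m : ℕ) := by positivity
  set e : ℕ → ℂ := fun k => Complex.exp (-(2 * Complex.I * k * (Real.pi * (d : ℕ) / 2 ^ m))) with he
  set S : ℂ := ∑ k ∈ Finset.range (2 ^ m), e k * s k with hS
  set T : ℂ := ∑ k ∈ Finset.range (2 ^ m), e k * t k with hT
  have hst : ∀ r : Work b c, ‖estimationState m P f δ l (r, d)‖ ^ 2
      = (if r.2.2 then ‖S‖ ^ 2 else ‖T‖ ^ 2) / ((2 ^ m : ℕ) : ℝ) ^ 2 * ‖ψ r‖ ^ 2 := by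
    rintro ⟨ξ, φ, z⟩
    rw [estimationState_apply]
    simp only [← hψ, hq, ← mul_assoc]
    rw [← Finset.sum_mul, norm_div, norm_mul, div_pow, mul_pow, norm_pow, Complex.norm_ofNat,
      show (2 : ℝ) ^ m = ((2 ^ m : ℕ) : ℝ) by push_cast; rfl]
    cases z
    · simp only [Bool.false_eq_true, if_false]
      rw [← hT]
      ring
    · simp only [if_true]
      rw [← hS]
      ring
  have hcos : ∑ r : Work b c with ¬ r.2.2 = true, ‖ψ r‖ ^ 2 = Real.cos θ ^ 2 := by
    have h1 := Finset.sum_filter_add_sum_filter_not Finset.univ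
      (fun r : Work b c => r.2.2 = true) (fun r => ‖ψ r‖ ^ 2)
    rw [hnorm] at h1
    have h2 := Real.sin_sq_add_cos_sq θ
    rw [← hθ, goodProb] at h2
    linarith
  have hprob : outcomeProb (estimationState m P f δ l) d
      = (‖S‖ ^ 2 * Real.sin θ ^ 2 + ‖T‖ ^ 2 * Real.cos θ ^ 2) / ((2 ^ m : ℕ) : ℝ) ^ 2 := by
    rw [outcomeProb]
    simp only [hst]
    rw [← hcos, ← hθ, goodProb, Finset.mul_sum, Finset.mul_sum, Finset.sum_filter,
      Finset.sum_filter, ← Finset.sum_add_distrib, Finset.sum_div]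
    apply Finset.sum_congr rfl
    rintro ⟨ξ, φ, z⟩ _
    cases z <;> simp <;> ring
  have hS' : Real.sin θ * S = ∑ k ∈ Finset.range (2 ^ m), e k * Real.sin ((2 * k + 1) * θ) := by
    rw [hS, Finset.mul_sum]
    apply Finset.sum_congr rfl
    intro k _
    rw [← hs]
    push_cast
    ring
  have hT' : Real.cos θ * T = ∑ k ∈ Finset.range (2 ^ m), e k * Real.cos ((2 * k + 1) * θ) := by
    rw [hT, Finset.mul_sum]
    apply Finset.sum_congr rfl
    intro k _
    rw [← ht]
    push_cast
    ring
  have hplus : ‖Real.cos θ * T + Complex.I * (Real.sin θ * S)‖ ^ 2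
      = fejer (2 ^ m) (θ - Real.pi * (d : ℕ) / (2 ^ m : ℕ)) * ((2 ^ m : ℕ) : ℝ) ^ 2 := by
    have h1 : Real.cos θ * T + Complex.I * (Real.sin θ * S) = Complex.exp (θ * Complex.I) *
        ∑ k ∈ Finset.range (2 ^ m),
          Complex.exp (2 * Complex.I * k * (θ - Real.pi * (d : ℕ) / (2 ^ m : ℕ) : ℝ)) := by
      rw [hS', hT', Finset.mul_sum, Finset.mul_sum, ← Finset.sum_add_distrib]
      apply Finset.sum_congr rfl
      intro k _
      have h2 : (Real.cos ((2 * k + 1) * θ) : ℂ) + Real.sin ((2 * k + 1) * θ) * Complex.I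
          = Complex.exp (((2 * k + 1) * θ : ℝ) * Complex.I) := by
        rw [Complex.exp_mul_I, Complex.ofReal_cos, Complex.ofReal_sin]
      rw [show e k * (Real.cos ((2 * k + 1) * θ) : ℂ)
          + Complex.I * (e k * (Real.sin ((2 * k + 1) * θ) : ℂ))
          = e k * (Real.cos ((2 * k + 1) * θ) + Real.sin ((2 * k + 1) * θ) * Complex.I) by ring,
        h2, he, ← Complex.exp_add, ← Complex.exp_add]
      congr 1
      push_cast
      ring
    rw [h1, norm_mul, Complex.norm_exp_ofReal_mul_I, one_mul, fejer,
      div_mul_cancel₀ _ (pow_ne_zero 2 hMpos.ne')]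
  have hminus : ‖Real.cos θ * T - Complex.I * (Real.sin θ * S)‖ ^ 2
      = fejer (2 ^ m) (-θ - Real.pi * (d : ℕ) / (2 ^ m : ℕ)) * ((2 ^ m : ℕ) : ℝ) ^ 2 := by
    have h1 : Real.cos θ * T - Complex.I * (Real.sin θ * S)
        = Complex.exp ((-θ : ℝ) * Complex.I) *
        ∑ k ∈ Finset.range (2 ^ m),
          Complex.exp (2 * Complex.I * k * (-θ - Real.pi * (d : ℕ) / (2 ^ m : ℕ) : ℝ)) := by
      rw [hS', hT', Finset.mul_sum, Finset.mul_sum, ← Finset.sum_sub_distrib]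
      apply Finset.sum_congr rfl
      intro k _
      have h2 : (Real.cos ((2 * k + 1) * θ) : ℂ) - Real.sin ((2 * k + 1) * θ) * Complex.I
          = Complex.exp ((-((2 * k + 1) * θ) : ℝ) * Complex.I) := by
        rw [Complex.exp_mul_I, ← Complex.ofReal_cos, ← Complex.ofReal_sin, Real.cos_neg,
          Real.sin_neg]
        push_cast
        ring
      rw [show e k * (Real.cos ((2 * k + 1) * θ) : ℂ)
          - Complex.I * (e k * (Real.sin ((2 * k + 1) * θ) : ℂ))
          = e k * (Real.cos ((2 * k + 1) * θ) - Real.sin ((2 * k + 1) * θ) * Complex.I) by ring,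
        h2, he, ← Complex.exp_add, ← Complex.exp_add]
      congr 1
      push_cast
      ring
    rw [h1, norm_mul, Complex.norm_exp_ofReal_mul_I, one_mul, fejer,
      div_mul_cancel₀ _ (pow_ne_zero 2 hMpos.ne')]
  -- The combinations `cos θ T ± i sin θ S` are geometric sums, one for each eigenphase. The
  -- parallelogram law turns the good and bad probabilities into the average of their kernels.
  have hpar := parallelogram_law_with_norm ℂ (Real.cos θ * T) (Complex.I * (Real.sin θ * S))
  simp only [hplus, hminus] at hpar
  rw [norm_mul, norm_mul, norm_mul, Complex.norm_I, Complex.norm_real, Complex.norm_real, one_mul,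
    mul_pow, mul_pow, Real.norm_eq_abs, Real.norm_eq_abs, sq_abs, sq_abs] at hpar
  rw [hprob, div_eq_iff (by positivity)]
  linarith

/-- Amplitude estimation finds the probability of the good outcome up to `π / M` with
probability at least `8 / π²`. -/
theorem eight_div_pi_sq_le_outcomeProb {b c : ℕ} (m : ℕ) {P : Matrix (Bits b) (Bits b) ℂ}
    (hP : P ∈ Matrix.unitaryGroup (Bits b) ℂ) (f : Bits b → Bits c → Bool) (δ : ℝ) (l : ℕ) :
    8 / Real.pi ^ 2 ≤ ∑ d ∈ Finset.univ.filter (fun d : Fin (2 ^ m) =>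
        |estimate m d - goodProb (algA P f δ l *ᵥ ketZero b c)| ≤ Real.pi / 2 ^ m),
      outcomeProb (estimationState m P f δ l) d := by
  set a := goodProb (algA P f δ l *ᵥ ketZero b c) with ha
  have ha0 : 0 ≤ a := Finset.sum_nonneg fun _ _ => sq_nonneg _
  have ha1 : a ≤ 1 := by
    rw [← sum_norm_sq_algA hP f δ l]
    exact Finset.sum_le_sum_of_subset_of_nonneg (Finset.filter_subset _ _)
      fun _ _ _ => sq_nonneg _
  set θ := Real.arcsin (Real.sqrt a)
  have hθ : a = Real.sin θ ^ 2 := by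
    rw [Real.sin_arcsin (by linarith [Real.sqrt_nonneg a]) (Real.sqrt_le_one.2 ha1),
      Real.sq_sqrt ha0]
  simp only [outcomeProb_estimationState m hP f δ l hθ]
  rw [← Finset.sum_div, Finset.sum_add_distrib]
  have hpos : 0 < 2 ^ m := Nat.two_pow_pos m
  have hsub : ∀ θ' : ℝ, Real.sin θ' ^ 2 = a →
      8 / Real.pi ^ 2 ≤ ∑ d ∈ Finset.univ.filter (fun d : Fin (2 ^ m) =>
        |estimate m d - a| ≤ Real.pi / 2 ^ m),
        fejer (2 ^ m) (θ' - Real.pi * (d : ℕ) / (2 ^ m : ℕ)) := by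
    intro θ' hθ'
    refine (eight_div_pi_sq_le_sum_fejer hpos θ').trans ?_
    apply Finset.sum_le_sum_of_subset_of_nonneg
    · intro d hd
      rw [Finset.mem_filter] at hd ⊢
      refine ⟨Finset.mem_univ _, ?_⟩
      have h := hd.2
      push_cast at h
      set x : ℝ := Real.pi * (d : ℕ) / 2 ^ m
      have hx : estimate m d = Real.sin x ^ 2 := by
        rw [estimate, mul_comm]
      -- This factorization lets `|sin (θ' + x)| ≤ 1` discard one factor, leaving the distance
      -- controlled by the kernel bound.
      have hdiff : Real.sin x ^ 2 - Real.sin θ' ^ 2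
          = -(Real.sin (θ' - x) * Real.sin (θ' + x)) := by
        rw [Real.sin_sub, Real.sin_add]
        linear_combination Real.sin θ' ^ 2 * Real.sin_sq_add_cos_sq x
          - Real.sin x ^ 2 * Real.sin_sq_add_cos_sq θ'
      rw [hx, ← hθ', hdiff, abs_neg, abs_mul]
      exact (mul_le_of_le_one_right (abs_nonneg _) (Real.abs_sin_le_one _)).trans h
    · exact fun d _ _ => fejer_nonneg _ _
  have h1 := hsub θ hθ.symm
  have h2 := hsub (-θ) (by rw [Real.sin_neg, neg_sq, hθ])
  linarith

/-! ### Query algorithms -/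

/-- `F` is computed by a query algorithm with exactly `n` oracle calls. -/
def Realizes {b c m : ℕ} (n : ℕ)
    (F : (Bits b → Bits c → Bool) → Matrix (Reg b c m) (Reg b c m) ℂ) : Prop :=
  ∃ C : QueryAlgorithm b c m, queryCount C = n ∧
    ∀ f, (C.map (Gate.toMatrix f)).reverse.prod = F f

lemma foldl_toMatrix {b c m : ℕ} (C : QueryAlgorithm b c m) (f : Bits b → Bits c → Bool)
    (ψ : Reg b c m → ℂ) :
    C.foldl (fun ψ g => g.toMatrix f *ᵥ ψ) ψ = (C.map (Gate.toMatrix f)).reverse.prod *ᵥ ψ := by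
  induction C generalizing ψ with
  | nil => simp
  | cons g C ih =>
    rw [List.foldl_cons, ih, List.map_cons, List.reverse_cons, List.prod_append,
      ← Matrix.mulVec_mulVec]
    simp

lemma Realizes.free {b c m : ℕ} {U : Matrix (Reg b c m) (Reg b c m) ℂ}
    (hU : U ∈ Matrix.unitaryGroup (Reg b c m) ℂ) : Realizes 0 fun _ => U :=
  ⟨[.free ⟨U, hU⟩], by simp [queryCount, Gate.cost], fun f => by simp [Gate.toMatrix]⟩

lemma Realizes.query {b c m : ℕ} :
    Realizes 1 fun f : Bits b → Bits c → Bool =>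
      oracle f ⊗ₖ (1 : Matrix (Fin (2 ^ m)) (Fin (2 ^ m)) ℂ) :=
  ⟨[.query], by simp [queryCount, Gate.cost], fun f => by simp [Gate.toMatrix]⟩

lemma Realizes.mul {b c m n k : ℕ}
    {F G : (Bits b → Bits c → Bool) → Matrix (Reg b c m) (Reg b c m) ℂ}
    (hF : Realizes n F) (hG : Realizes k G) : Realizes (n + k) fun f => F f * G f := by
  obtain ⟨C, hC, hCF⟩ := hF
  obtain ⟨D, hD, hDG⟩ := hG
  refine ⟨D ++ C, ?_, fun f => ?_⟩
  · rw [← hC, ← hD, queryCount, List.map_append, List.sum_append, add_comm]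
    rfl
  · rw [List.map_append, List.reverse_append, List.prod_append, hCF, hDG]

lemma Realizes.one {b c m : ℕ} :
    Realizes 0 fun _ : Bits b → Bits c → Bool => (1 : Matrix (Reg b c m) (Reg b c m) ℂ) :=
  Realizes.free (one_mem _)

lemma Realizes.pow {b c m n : ℕ}
    {F : (Bits b → Bits c → Bool) → Matrix (Reg b c m) (Reg b c m) ℂ}
    (hF : Realizes n F) (k : ℕ) : Realizes (k * n) fun f => F f ^ k := by
  induction k with
  | zero => simpa using Realizes.one
  | succ k ih =>
    rw [add_mul, one_mul]
    simpa only [pow_succ] using ih.mul hF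

/-- The inverse of a step. -/
def Gate.inverse {b c m : ℕ} : Gate b c m → Gate b c m
  | .free U => .free U⁻¹
  | .query => .query

lemma Gate.toMatrix_inverse {b c m : ℕ} (f : Bits b → Bits c → Bool) (g : Gate b c m) :
    g.inverse.toMatrix f = (g.toMatrix f)ᴴ := by
  cases g with
  | free U => rfl
  | query =>
    simp only [Gate.inverse, Gate.toMatrix]
    rw [Matrix.conjTranspose_kronecker, conjTranspose_oracle, Matrix.conjTranspose_one]

lemma Gate.cost_inverse {b c m : ℕ} (g : Gate b c m) : g.inverse.cost = g.cost := by
  cases g <;> rfl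

lemma Realizes.conjTranspose {b c m n : ℕ}
    {F : (Bits b → Bits c → Bool) → Matrix (Reg b c m) (Reg b c m) ℂ}
    (hF : Realizes n F) : Realizes n fun f => (F f)ᴴ := by
  obtain ⟨C, hC, hCF⟩ := hF
  refine ⟨(C.map Gate.inverse).reverse, ?_, fun f => ?_⟩
  · rw [← hC, queryCount, queryCount, List.map_reverse, List.sum_reverse, List.map_map]
    congr 2
    ext g
    exact g.cost_inverse
  · beta_reduce
    rw [← hCF, Matrix.conjTranspose_list_prod, List.map_reverse, List.map_reverse,
      List.reverse_reverse, List.reverse_reverse, List.map_map, List.map_map]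
    congr 2
    ext1 g
    exact g.toMatrix_inverse f

/-! ### The algorithm -/

/-- An operator of the working register, on the whole register. -/
def onWork {b c : ℕ} (m : ℕ) (U : Matrix (Work b c) (Work b c) ℂ) :
    Matrix (Reg b c m) (Reg b c m) ℂ :=
  U ⊗ₖ (1 : Matrix (Fin (2 ^ m)) (Fin (2 ^ m)) ℂ)

lemma onWork_mul {b c m : ℕ} (U V : Matrix (Work b c) (Work b c) ℂ) :
    onWork m (U * V) = onWork m U * onWork m V := by
  rw [onWork, onWork, onWork, ← Matrix.mul_kronecker_mul, mul_one]

lemma onWork_mem_unitaryGroup {b c : ℕ} (m : ℕ) {U : Matrix (Work b c) (Work b c) ℂ}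
    (hU : U ∈ Matrix.unitaryGroup (Work b c) ℂ) :
    onWork m U ∈ Matrix.unitaryGroup (Reg b c m) ℂ :=
  Matrix.kronecker_mem_unitary hU (one_mem _)

lemma realizes_groverProduct {b c : ℕ} (m : ℕ) (δ : ℝ) (l k : ℕ) :
    Realizes (2 * k) fun f : Bits b → Bits c → Bool => onWork m (groverProduct f δ l k) := by
  induction k with
  | zero =>
    simp only [groverProduct, onWork, Matrix.one_kronecker_one]
    exact Realizes.one
  | succ k ih =>
    have h1 := (Realizes.free (onWork_mem_unitaryGroup m (neg_mem_unitaryGroup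
      (plusReflection_mem_unitaryGroup b c (alphaPhase δ l (k + 1)))))).mul
      ((Realizes.query.mul (Realizes.free (onWork_mem_unitaryGroup m
        (ancillaPhase_mem_unitaryGroup b c (betaPhase δ l (k + 1)))))).mul Realizes.query)
    have h2 := h1.mul ih
    convert h2 using 1
    · ring
    · ext1 f
      rw [groverProduct, groverIterate, targetReflection, ← neg_mul]
      simp only [onWork_mul]
      rfl

lemma realizes_algA {b c : ℕ} (m : ℕ) {P : Matrix (Bits b) (Bits b) ℂ}
    (hP : P ∈ Matrix.unitaryGroup (Bits b) ℂ) (δ : ℝ) (l : ℕ) :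
    Realizes (2 * l + 1) fun f : Bits b → Bits c → Bool => onWork m (algA P f δ l) := by
  have h := (Realizes.query.mul (realizes_groverProduct (b := b) (c := c) m δ l l)).mul
    (Realizes.free (onWork_mem_unitaryGroup m (prep_mem_unitaryGroup c hP)))
  convert h using 1
  · ring
  · ext1 f
    rw [algA, amplification, onWork_mul, onWork_mul]
    rfl

/-- `U`, controlled by the `j`-th sample qubit. -/
def controlled {b c : ℕ} (m j : ℕ) (U : Matrix (Work b c) (Work b c) ℂ) :
    Matrix (Reg b c m) (Reg b c m) ℂ :=
  Matrix.blockDiagonal fun d : Fin (2 ^ m) => if (d : ℕ).testBit j then U else 1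

lemma controlled_mem_unitaryGroup {b c : ℕ} (m j : ℕ) {U : Matrix (Work b c) (Work b c) ℂ}
    (hU : U ∈ Matrix.unitaryGroup (Work b c) ℂ) :
    controlled m j U ∈ Matrix.unitaryGroup (Reg b c m) ℂ := by
  rw [Matrix.mem_unitaryGroup_iff, Matrix.star_eq_conjTranspose] at hU ⊢
  rw [controlled, Matrix.blockDiagonal_conjTranspose, ← Matrix.blockDiagonal_mul]
  refine (congrArg Matrix.blockDiagonal ?_).trans Matrix.blockDiagonal_one
  ext1 d
  split_ifs
  · exact hU
  · simp

lemma controlledPower_eq_pow {b c : ℕ} (m j : ℕ) (U : Matrix (Work b c) (Work b c) ℂ) :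
    controlledPower m U j = controlled m j U ^ 2 ^ j := by
  rw [controlledPower, controlled, ← Matrix.blockDiagonal_pow]
  congr 1
  ext1 d
  rw [Pi.pow_apply]
  split_ifs <;> simp

/-- When the control is off, `A` and its adjoint cancel. Controlling the two oracle-free reflections
is enough, so no controlled oracle call is needed. -/
lemma controlled_algQ {b c : ℕ} (m j : ℕ) {P : Matrix (Bits b) (Bits b) ℂ}
    (hP : P ∈ Matrix.unitaryGroup (Bits b) ℂ) (f : Bits b → Bits c → Bool) (δ : ℝ) (l : ℕ) :
    controlled m j (algQ P f δ l)
      = onWork m (algA P f δ l) * controlled m j (zeroReflection b c)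
        * (onWork m (algA P f δ l))ᴴ * controlled m j (negAncillaZ b c) := by
  have hA := Matrix.mem_unitaryGroup_iff.1 (algA_mem_unitaryGroup hP f δ l)
  rw [Matrix.star_eq_conjTranspose] at hA
  rw [onWork, Matrix.kronecker_one, Matrix.blockDiagonal_conjTranspose]
  simp only [controlled]
  rw [← Matrix.blockDiagonal_mul, ← Matrix.blockDiagonal_mul, ← Matrix.blockDiagonal_mul]
  congr 1
  ext1 d
  split_ifs
  · rfl
  · rw [mul_one, mul_one, hA]

/-- There are `1 + 2 + ⋯ + 2 ^ (k - 1)` uses of `Q`, each containing `A` and its adjoint. -/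
lemma realizes_prod_controlledPower {b c : ℕ} (m : ℕ) {P : Matrix (Bits b) (Bits b) ℂ}
    (hP : P ∈ Matrix.unitaryGroup (Bits b) ℂ) (δ : ℝ) (l k : ℕ) :
    Realizes ((2 ^ k - 1) * (2 * (2 * l + 1))) fun f : Bits b → Bits c → Bool =>
      ((List.range k).map (controlledPower m (algQ P f δ l))).prod := by
  induction k with
  | zero => simpa using Realizes.one
  | succ k ih =>
    have hA := realizes_algA (c := c) m hP δ l
    have hQ := ((hA.mul (Realizes.free (controlled_mem_unitaryGroup m k
      (zeroReflection_mem_unitaryGroup b c)))).mul hA.conjTranspose).mul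
      (Realizes.free (controlled_mem_unitaryGroup m k (negAncillaZ_mem_unitaryGroup b c)))
    have h := ih.mul (hQ.pow (2 ^ k))
    convert h using 1
    · obtain ⟨n, hn⟩ := Nat.exists_eq_succ_of_ne_zero (Nat.two_pow_pos k).ne'
      rw [pow_succ, hn, show n.succ * 2 - 1 = 2 * n + 1 by omega,
        show n.succ - 1 = n by omega, Nat.succ_eq_add_one]
      ring
    · ext1 f
      rw [List.range_succ, List.map_append, List.prod_append, ← controlled_algQ m k hP f,
        ← controlledPower_eq_pow]
      simp

/-! ### Idle oracle calls and assembly of the circuit -/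

lemma hadamardBit_mem_unitaryGroup : hadamardBit ∈ Matrix.unitaryGroup Bool ℂ := by
  rw [Matrix.mem_unitaryGroup_iff, Matrix.star_eq_conjTranspose]
  ext s t
  rw [Matrix.mul_apply, Matrix.one_apply, ← hadamardBit_mul_star s t]
  rfl

/-- The Hadamard gate on the ancilla. -/
def ancillaHadamard (b c : ℕ) : Matrix (Work b c) (Work b c) ℂ :=
  (1 : Matrix (Bits b) (Bits b) ℂ) ⊗ₖ ((1 : Matrix (Bits c) (Bits c) ℂ) ⊗ₖ hadamardBit)

lemma ancillaHadamard_mem_unitaryGroup (b c : ℕ) :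
    ancillaHadamard b c ∈ Matrix.unitaryGroup (Work b c) ℂ :=
  Matrix.kronecker_mem_unitary (one_mem _)
    (Matrix.kronecker_mem_unitary (one_mem _) hadamardBit_mem_unitaryGroup)

lemma onWork_oracle_mulVec {b c m : ℕ} (f : Bits b → Bits c → Bool) (ψ : Reg b c m → ℂ)
    (r : Work b c) (d : Fin (2 ^ m)) :
    (onWork m (oracle f) *ᵥ ψ) (r, d) = ψ ((r.1, r.2.1, xor r.2.2 (f r.1 r.2.1)), d) := by
  rw [← oracle_mulVec f (fun r => ψ (r, d)) r, onWork, Matrix.mulVec, dotProduct,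
    Fintype.sum_prod_type, Matrix.mulVec, dotProduct]
  apply Finset.sum_congr rfl
  intro r' _
  simp [Matrix.kroneckerMap_apply, Matrix.one_apply]

/-- With the ancilla in the state `|+⟩`, the oracle acts trivially. -/
lemma oracle_mulVec_plus {b c m : ℕ} (f : Bits b → Bits c → Bool) :
    onWork m (oracle f) *ᵥ (onWork m (ancillaHadamard b c) *ᵥ initState b c m)
      = onWork m (ancillaHadamard b c) *ᵥ initState b c m := by
  ext ⟨⟨ξ, φ, z⟩, d⟩
  rw [onWork_oracle_mulVec, initState, Matrix.mulVec_single_one, Matrix.col_apply,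
    Matrix.col_apply]
  simp [onWork, ancillaHadamard, zeroWork, hadamardBit, Matrix.kroneckerMap_apply]

/-- Any number of oracle calls can be spent without an effect on the initial state. -/
lemma exists_idle_queries (b c m n : ℕ) :
    ∃ F : (Bits b → Bits c → Bool) → Matrix (Reg b c m) (Reg b c m) ℂ,
      Realizes n F ∧ ∀ f, F f *ᵥ initState b c m = initState b c m := by
  have hH := onWork_mem_unitaryGroup m (ancillaHadamard_mem_unitaryGroup b c)
  -- A Hadamard gate puts the ancilla into `|+⟩`, which every oracle call fixes; its adjoint
  -- restores `|0⟩`.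
  refine ⟨fun f => (onWork m (ancillaHadamard b c))ᴴ * onWork m (oracle f) ^ n
    * onWork m (ancillaHadamard b c), ?_, fun f => ?_⟩
  · simpa [onWork] using ((Realizes.free hH).conjTranspose.mul (Realizes.query.pow n)).mul
      (Realizes.free hH)
  have hpow : ∀ k : ℕ, onWork m (oracle f) ^ k *ᵥ
      (onWork m (ancillaHadamard b c) *ᵥ initState b c m)
        = onWork m (ancillaHadamard b c) *ᵥ initState b c m := by
    intro k
    induction k with
    | zero => simp
    | succ k ih => rw [pow_succ, ← Matrix.mulVec_mulVec, oracle_mulVec_plus, ih]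
  have hH' := Matrix.mem_unitaryGroup_iff'.1 hH
  rw [Matrix.star_eq_conjTranspose] at hH'
  rw [← Matrix.mulVec_mulVec, ← Matrix.mulVec_mulVec]
  rw [hpow, Matrix.mulVec_mulVec, hH', Matrix.one_mulVec]

/-- Amplitude estimation, as a product of operators applied to the initial state. -/
lemma estimationState_eq_mulVec {b c : ℕ} (m : ℕ) (P : Matrix (Bits b) (Bits b) ℂ)
    (f : Bits b → Bits c → Bool) (δ : ℝ) (l : ℕ) :
    estimationState m P f δ l
      = (((1 : Matrix (Work b c) (Work b c) ℂ) ⊗ₖ (qft m)ᴴ)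
          * ((List.range m).map (controlledPower m (algQ P f δ l))).prod
          * onWork m (algA P f δ l)
          * ((1 : Matrix (Work b c) (Work b c) ℂ) ⊗ₖ qft m)) *ᵥ initState b c m := by
  rw [mul_assoc, ← Matrix.mulVec_mulVec, ← Matrix.mulVec_mulVec, estimationState]
  congr 2
  -- The zeroth column of the Fourier matrix is constant, so the transform itself prepares the
  -- uniform superposition of sample values.
  rw [onWork, ← Matrix.mul_kronecker_mul, mul_one, one_mul, initState, Matrix.mulVec_single_one]
  ext ⟨r, d⟩
  rw [Matrix.col_apply, Matrix.kroneckerMap_apply, ketZero, Matrix.mulVec_single_one,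
    Matrix.col_apply]
  simp [qft]

end Reqo

end

open Reqo
theorem theorem1 (b c m : ℕ) (p : Bits b → ℝ) (hp : ∀ ξ, 0 ≤ p ξ) (hp1 : ∑ ξ, p ξ = 1)
    (P : Matrix.unitaryGroup (Bits b) ℂ)
    (hP : ∀ ξ, (P : Matrix (Bits b) (Bits b) ℂ) ξ (zeroBits b) = (Real.sqrt (p ξ) : ℂ))
    (δ : ℝ) (hδ0 : 0 < δ) (hδ1 : δ ≤ 1)
    (lamT : ℝ) (hlam0 : 1 / 2 ^ c ≤ lamT) (hlam1 : lamT ≤ 1) :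
    ∃ C : QueryAlgorithm b c m,
      queryCount C = (depthT δ lamT + 1) * (2 * 2 ^ m - 1) ∧
      ∀ f : Bits b → Bits c → Bool,
        finalState C f = estimationState m P f δ (depthT δ lamT / 2) ∧
        8 / Real.pi ^ 2 ≤
          ∑ d with |estimate m d - mu p f| ≤
              epsT p f lamT + δ ^ 2 * mu p f - δ ^ 2 * epsT p f lamT
                + Real.pi / 2 ^ m + Real.pi ^ 2 / (2 ^ m) ^ 2,
            outcomeProb (finalState C f) d := by
  have hlam : 0 < lamT := lt_of_lt_of_le (by positivity) hlam0
  set D := depthT δ lamT with hD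
  set l := D / 2 with hl
  -- Here `D - 2 l` is the parity of `D`. It makes up the difference between `D + 1` and `L = 2 l +
  -- 1`, once for each of the `2 M - 1` uses of `A` or its adjoint.
  obtain ⟨F, hF, hFinit⟩ := exists_idle_queries b c m ((D - 2 * l) * (2 * 2 ^ m - 1))
  have hq := qft_mem_unitaryGroup m
  have h1 : (1 : Matrix (Work b c) (Work b c) ℂ) ⊗ₖ qft m
      ∈ Matrix.unitaryGroup (Reg b c m) ℂ := Matrix.kronecker_mem_unitary (one_mem _) hq
  have h2 : (1 : Matrix (Work b c) (Work b c) ℂ) ⊗ₖ (qft m)ᴴ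
      ∈ Matrix.unitaryGroup (Reg b c m) ℂ :=
    Matrix.kronecker_mem_unitary (one_mem _) (Unitary.star_mem hq)
  obtain ⟨C, hC, hCmat⟩ := ((((Realizes.free h2).mul
    (realizes_prod_controlledPower (c := c) m P.2 δ l m)).mul (realizes_algA m P.2 δ l)).mul
      (Realizes.free h1)).mul hF
  refine ⟨C, ?_, fun f => ?_⟩
  · have hpos := Nat.two_pow_pos m
    obtain ⟨n, hn⟩ := Nat.exists_eq_succ_of_ne_zero hpos.ne'
    have hl2 : 2 * l ≤ D := by omega
    obtain ⟨k, hk⟩ := Nat.exists_eq_add_of_le hl2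
    rw [hC, hn, show 2 * n.succ - 1 = 2 * n + 1 by omega, show n.succ - 1 = n by omega,
      show D - 2 * l = k by omega, hk]
    ring
  · have hstate : finalState C f = estimationState m P f δ l := by
      rw [finalState, foldl_toMatrix, hCmat, ← Matrix.mulVec_mulVec, hFinit,
        estimationState_eq_mulVec]
    refine ⟨hstate, ?_⟩
    rw [hstate]
    refine (eight_div_pi_sq_le_outcomeProb m P.2 f δ l).trans ?_
    apply Finset.sum_le_sum_of_subset_of_nonneg
    · intro d hd
      rw [Finset.mem_filter] at hd ⊢
      refine ⟨Finset.mem_univ _, ?_⟩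
      have ha := abs_goodProb_sub_mu_le hp hP hδ0 hδ1 hlam f
      have htri := abs_sub_le (estimate m d)
        (goodProb (algA (P : Matrix (Bits b) (Bits b) ℂ) f δ l *ᵥ ketZero b c)) (mu p f)
      -- Estimation is already accurate to `π / M`, so the quadratic term of the bound is only
      -- slack.
      have hpi : 0 ≤ Real.pi ^ 2 / (2 ^ m) ^ 2 := by positivity
      linarith [hd.2]
    · exact fun d _ _ => Finset.sum_nonneg fun _ _ => sq_nonneg _
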